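/- **Characterisation of encodings of simple algebras.** *Definitions.* Write $a\circ b=\tfrac12(ab+ba)$. A *special JB algebra* in an associative real $*$-algebra $R$ is a real linear subspace $A\subseteq R$ of self-adjoint elements that contains $1$, is closed under $\circ$, and has a complete norm with $\|a\circ b\|\le\|a\|\|b\|$, $\|a^2\|=\|a\|^2$ and $\|a^2\|\le\|a^2+b^2\|$ for all $a,b\in A$. It is *simple* if $A\neq 0$ and its only Jordan ideals are $0$ and $A$. It is a *spin factor* if $A=\mathbb R 1\oplus V$ for a subspace $V$ with $v^2\in\mathbb R 1$ for all $v\in V$. An *encoding* is a map $\gamma:A\to B$ between special JB algebras with $\operatorname{spec}\gamma(a)=\operatorname{spec}a$ and $\gamma(ta_1+(1-t)a_2)=t\gamma(a_1)+(1-t)\gamma(a_2)$ for all $a,a_1,a_2\in A$ and $t\in[0,1]$ (spectra are taken in the ambient associative algebras). *Setting.* Let $A\subseteq M_n(\mathbb C)$ be a simple special JB algebra which generates $M_n(\mathbb C)$ as a complex associative algebra. Let $\mathcal A$ be any real unital $*$-subalgebra with $A\subseteq\mathcal A\subseteq M_n(\mathbb C)$; for example $\mathcal A=M_n(\mathbb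 C)$, or the real associative algebra generated by $A$. Let $\mathcal B=\bigoplus_i\mathcal B_i$ be a finite direct sum with $\mathcal B_i=M_{m_i}(\mathbb C)$, let $B\subseteq\mathcal B$ be a special JB algebra (hence semisimple), and let $\gamma:A\to B$ be an encoding. An *extended encoding* of $\gamma$ is a unital ring homomorphism $\Gamma:\mathcal A\to\mathcal B$ with $\Gamma|_A=\gamma$ and $\Gamma(\alpha^*)=\Gamma(\alpha)^*$ for all $\alpha\in\mathcal A$. *Statement.* 1. (Existence.) Unless $A$ is a spin factor of real dimension $4k+2$ for some integer $k\ge1$, an extended encoding $\Gamma:\mathcal A\to\mathcal B$ of $\gamma$ exists. 2. (Uniqueness.) If $\mathcal A$ is the real associative algebra generated by $A$ (for instance if $A=\mathrm{Herm}_n(\mathbb C)$ with $n\ge2$ and $\mathcal A=M_n(\mathbb C)$), then at most one unital ring homomorphism $\mathcal A\to\mathcal B$ extends $\gamma$, and any such homomorphism automatically preserves $*$. 3. (Form.) For every extended encoding $\Gamma$ there are $p_i,q_i\in\mathbb N_0$ with $n(p_i+q_i)=m_i$, i.e. $p_i+q_i=m_i/n$, and a unitary $U\in\mathcal B$ such that,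 after identifying the coordinates $\mathbb C^n\otimes\mathbb C^{p_i+q_i}$ with those of $\mathbb C^{m_i}$ by a suitable bijection of standard basis vectors, $$\Gamma(\alpha)=U\Big(\bigoplus_i\big(\alpha^{\oplus p_i}\oplus\bar\alpha^{\oplus q_i}\big)\Big)U^*\qquad\text{for all }\alpha\in\mathcal A,$$ where $\bar\alpha$ is the entrywise complex conjugate of $\alpha$. -/

import Mathlib

/-- The Jordan product `a ∘ b = (ab + ba) / 2` of an associative real algebra. -/
noncomputable def jordanMul {R : Type*} [Ring R] [Algebra ℝ R] (a b : R) : R :=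
  (1 / 2 : ℝ) • (a * b + b * a)

/-- A unital special JB algebra of self-adjoint elements of an associative `*`-algebra `R`:
a real subspace of self-adjoint elements, containing `1`, closed under the Jordan product, and
carrying a complete norm with the three JB axioms. -/
structure IsSpecialJB {R : Type*} [Ring R] [StarRing R] [Algebra ℝ R]
    (A : Submodule ℝ R) : Prop where
  one_mem : (1 : R) ∈ A
  isSelfAdjoint : ∀ a ∈ A, IsSelfAdjoint a
  jordan_mem : ∀ a ∈ A, ∀ b ∈ A, jordanMul a b ∈ A
  exists_norm : ∃ N : Seminorm ℝ A,
    (∀ a, N a = 0 → a = 0) ∧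
    (∀ u : ℕ → A, (∀ ε > 0, ∃ K, ∀ j ≥ K, ∀ k ≥ K, N (u j - u k) < ε) →
      ∃ l, ∀ ε > 0, ∃ K, ∀ k ≥ K, N (u k - l) < ε) ∧
    ∀ a b aa bb ab : A,
      (aa : R) = jordanMul (a : R) a → (bb : R) = jordanMul (b : R) b →
      (ab : R) = jordanMul (a : R) b →
        N ab ≤ N a * N b ∧ N aa = N a ^ 2 ∧ N aa ≤ N (aa + bb)

/-- A Jordan algebra `A` is simple: it is nonzero and its only Jordan ideals are `0` and `A`. -/
def IsSimpleJordan {R : Type*} [Ring R] [Algebra ℝ R] (A : Submodule ℝ R) : Prop :=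
  A ≠ ⊥ ∧ ∀ I : Submodule ℝ R, I ≤ A → (∀ a ∈ A, ∀ x ∈ I, jordanMul a x ∈ I) → I = ⊥ ∨ I = A

/-- `A` is a spin factor: `A = ℝ 1 ⊕ V`, where the square of each element of `V` is a scalar. -/
def IsSpinFactor {R : Type*} [Ring R] [Algebra ℝ R] (A : Submodule ℝ R) : Prop :=
  ∃ V : Submodule ℝ R, Disjoint (Submodule.span ℝ {(1 : R)}) V ∧
    Submodule.span ℝ {(1 : R)} ⊔ V = A ∧ ∀ v ∈ V, ∃ c : ℝ, v * v = c • (1 : R)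

/-- An encoding: a spectrum-preserving convex map. Spectra are taken in the ambient associative
algebras. -/
structure IsEncoding {R S : Type*} [Ring R] [Algebra ℝ R] [Algebra ℂ R]
    [Ring S] [Algebra ℝ S] [Algebra ℂ S] {A : Submodule ℝ R} {B : Submodule ℝ S}
    (γ : A → B) : Prop where
  spectrum_eq : ∀ a : A, spectrum ℂ (γ a : S) = spectrum ℂ (a : R)
  convex : ∀ a₁ a₂ : A, ∀ t : ℝ, 0 ≤ t → t ≤ 1 →
    γ (t • a₁ + (1 - t) • a₂) = t • γ a₁ + (1 - t) • γ a₂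

/-- The full matrix algebra `M_n(ℂ)`; its star is the conjugate transpose. -/
abbrev MatAlg (n : ℕ) : Type := Matrix (Fin n) (Fin n) ℂ

/-- The semisimple algebra `⨁ i, M_{m i}(ℂ)`. -/
abbrev SumMatAlg {ι : Type*} (m : ι → ℕ) : Type _ := ∀ i, MatAlg (m i)

/-- `𝒜` is an enveloping real `*`-algebra of `A` in `M_n(ℂ)`: it contains `A`, and `M_n(ℂ)` is
the complex associative algebra generated by `A`. -/
structure IsEnveloping {n : ℕ} (A : Submodule ℝ (MatAlg n))
    (𝒜 : StarSubalgebra ℝ (MatAlg n)) : Prop where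
  mem : ∀ a ∈ A, a ∈ 𝒜
  adjoin_eq_top : Algebra.adjoin ℂ (A : Set (MatAlg n)) = ⊤

/-- The ring homomorphism `Γ : 𝒜 → S` extends `γ : A → B ⊆ S`. -/
def Extends {R S : Type*} [Ring R] [StarRing R] [Algebra ℝ R] [StarModule ℝ R]
    [Ring S] [Algebra ℝ S] {A : Submodule ℝ R} {B : Submodule ℝ S}
    {𝒜 : StarSubalgebra ℝ R} (Γ : 𝒜 →+* S) (γ : A → B) : Prop :=
  ∀ (x : 𝒜) (a : A), (x : R) = a → Γ x = γ a

/-- An extended encoding of `γ`: a unital associative homomorphism of `*`-algebras that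
extends `γ`. -/
structure IsExtendedEncoding {R S : Type*} [Ring R] [StarRing R] [Algebra ℝ R] [StarModule ℝ R]
    [Ring S] [StarRing S] [Algebra ℝ S] {A : Submodule ℝ R} {B : Submodule ℝ S}
    {𝒜 : StarSubalgebra ℝ R} (Γ : 𝒜 →+* S) (γ : A → B) : Prop where
  extends_map : Extends Γ γ
  map_star : ∀ x, Γ (star x) = star (Γ x)

/-- The block diagonal matrix `α ⊕ ⋯ ⊕ α ⊕ ᾱ ⊕ ⋯ ⊕ ᾱ`, with `p` copies of `α` and `q` copies of
the entrywise complex conjugate `ᾱ`. -/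
def copies {n : ℕ} (p q : ℕ) (α : MatAlg n) :
    Matrix (Fin n × (Fin p ⊕ Fin q)) (Fin n × (Fin p ⊕ Fin q)) ℂ :=
  Matrix.blockDiagonal
    (Sum.elim (fun _ : Fin p => α) (fun _ : Fin q => α.map (starRingEnd ℂ)))

/-!
By the spectral theorem, a spectrum-preserving convex map is linear and sends orthogonal
projections to orthogonal projections, so each component `g : A → M_{m i}(ℂ)` of `γ` is a unital
Jordan homomorphism. Its graph `G ⊆ M_n(ℂ) × M_{m i}(ℂ)` is a Jordan algebra isomorphic to `A`, and
`g` extends to the real associative algebra generated by `A` as soon as the one generated by `G` is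
still a graph, i.e. contains no `x = (0, y)` with `y ≠ 0`.

If `A` is not a spin factor, then `1` is a sum of at least three minimal projections of `G`, linked
by partial isometries whose hermitian parts lie in `G`. Products of matrix coordinates are then
again coordinates of elements of `G` (the third index is needed here), whence `G` contains every
self-adjoint element of the algebra it generates. In particular `star x * x = (0, star y * y)` lies
in `G`, and so vanishes.

If `A` is a spin factor, then `G` generates a Clifford algebra. A nontrivial Clifford monomial
anticommutes with some generator, or is skew-adjoint, unless it is the product of all the
generators and their number is `1` modulo `4`, which the dimension hypothesis and simplicity
exclude. Hence on this algebra every real trace is determined by its value at `1`; as the trace of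
the first component of `star x * x` is zero, so is the trace of `star x * x`.

The extension passes to `M_n(ℂ)` by complexification, unless the real algebra is already all of
`M_n(ℂ)`. Finally, a real `*`-homomorphism `Ψ` on `M_n(ℂ)` is determined by the images of the matrix
units and by `Ψ(i)`, whose eigenvalues `i` and `-i` separate the copies of `α` from those of `ᾱ`.
-/

section JordanSubspace

open Polynomial

variable {W : Type*} [Ring W] [StarRing W] [Algebra ℝ W] {A : Submodule ℝ W}

theorem mem_of_add_self_mem {E : Type*} [AddCommGroup E] [Module ℝ E] {V : Submodule ℝ E} {x : E}
    (h : x + x ∈ V) : x ∈ V := by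
  rwa [← two_smul ℝ x, V.smul_mem_iff two_ne_zero] at h

/-- A real subspace of self-adjoint elements that contains `1` and is closed under the Jordan
product: an `IsSpecialJB` without its norm. The Jordan product is replaced by twice itself, the
anticommutator. -/
structure IsJordanSubspace (A : Submodule ℝ W) : Prop where
  one_mem : (1 : W) ∈ A
  star_eq : ∀ a ∈ A, star a = a
  mul_add_mul_mem : ∀ a ∈ A, ∀ b ∈ A, a * b + b * a ∈ A

theorem IsSpecialJB.isJordanSubspace (h : IsSpecialJB A) : IsJordanSubspace A where
  one_mem := h.one_mem
  star_eq := h.isSelfAdjoint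
  mul_add_mul_mem a ha b hb :=
    (A.smul_mem_iff (by norm_num : (1 / 2 : ℝ) ≠ 0)).1 (h.jordan_mem a ha b hb)

namespace IsJordanSubspace

theorem mul_self_mem (hA : IsJordanSubspace A) {a : W} (ha : a ∈ A) : a * a ∈ A :=
  mem_of_add_self_mem (hA.mul_add_mul_mem a ha a ha)

theorem mul_mem_of_commute (hA : IsJordanSubspace A) {a b : W} (ha : a ∈ A) (hb : b ∈ A)
    (h : Commute a b) : a * b ∈ A :=
  mem_of_add_self_mem (by simpa only [h.eq] using hA.mul_add_mul_mem a ha b hb)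

theorem triple_mem (hA : IsJordanSubspace A) {a b c : W} (ha : a ∈ A) (hb : b ∈ A) (hc : c ∈ A) :
    a * b * c + c * b * a ∈ A := by
  have hab_c := hA.mul_add_mul_mem _ (hA.mul_add_mul_mem a ha b hb) c hc
  have hbc_a := hA.mul_add_mul_mem _ (hA.mul_add_mul_mem b hb c hc) a ha
  have hac_b := hA.mul_add_mul_mem _ (hA.mul_add_mul_mem a ha c hc) b hb
  refine mem_of_add_self_mem ?_
  convert A.sub_mem (A.add_mem hab_c hbc_a) hac_b using 1
  noncomm_ring

theorem mul_mul_mem (hA : IsJordanSubspace A) {a b : W} (ha : a ∈ A) (hb : b ∈ A) :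
    a * b * a ∈ A :=
  mem_of_add_self_mem (hA.triple_mem ha hb ha)

theorem pow_mem (hA : IsJordanSubspace A) {a : W} (ha : a ∈ A) (k : ℕ) : a ^ k ∈ A := by
  induction k with
  | zero => simpa using hA.one_mem
  | succ k ih =>
    rw [pow_succ]
    exact hA.mul_mem_of_commute ih ha ((Commute.refl a).pow_left k)

theorem aeval_mem (hA : IsJordanSubspace A) {a : W} (ha : a ∈ A) (p : ℝ[X]) : aeval a p ∈ A := by
  rw [aeval_eq_sum_range]
  exact A.sum_mem fun i _ => A.smul_mem _ (hA.pow_mem ha i)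

end IsJordanSubspace

end JordanSubspace

section StarFormallyReal

open scoped Matrix ComplexOrder

/-- The involution of `W` is formally real: a sum of two elements `star x * x` vanishes only if
both of them do. -/
class StarFormallyReal (W : Type*) [Ring W] [StarRing W] : Prop where
  eq_zero_of_add : ∀ x y : W, star x * x + star y * y = 0 → x = 0

theorem eq_zero_of_star_mul_self_eq_zero {W : Type*} [Ring W] [StarRing W] [StarFormallyReal W]
    {x : W} (h : star x * x = 0) : x = 0 :=
  StarFormallyReal.eq_zero_of_add x 0 (by simp [h])

instance {μ : Type*} [Fintype μ] [DecidableEq μ] : StarFormallyReal (Matrix μ μ ℂ) where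
  eq_zero_of_add x y h := by
    have hx := (Matrix.posSemidef_conjTranspose_mul_self x).trace_nonneg
    have hy := (Matrix.posSemidef_conjTranspose_mul_self y).trace_nonneg
    have hsum : (xᴴ * x).trace + (yᴴ * y).trace = 0 := by
      rw [← Matrix.trace_add]
      exact (congrArg Matrix.trace h).trans (Matrix.trace_zero μ ℂ)
    exact Matrix.trace_conjTranspose_mul_self_eq_zero_iff.1
      ((add_eq_zero_iff_of_nonneg hx hy).1 hsum).1

instance {R S : Type*} [Ring R] [StarRing R] [StarFormallyReal R] [Ring S] [StarRing S]
    [StarFormallyReal S] : StarFormallyReal (R × S) where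
  eq_zero_of_add x y h :=
    Prod.ext (StarFormallyReal.eq_zero_of_add x.1 y.1 (congrArg Prod.fst h))
      (StarFormallyReal.eq_zero_of_add x.2 y.2 (congrArg Prod.snd h))

end StarFormallyReal

section SpectralDecomposition

open Polynomial

variable {W : Type*} [Ring W] [Algebra ℝ W]

theorem aeval_eq_of_eval_eq {b : W} {s : Finset ℝ} (hs : aeval b (Lagrange.nodal s id) = 0)
    {p q : ℝ[X]} (h : ∀ x ∈ s, p.eval x = q.eval x) : aeval b p = aeval b q := by
  have hdvd : Lagrange.nodal s id ∣ p - q := by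
    refine Finset.prod_dvd_of_coprime ?_ fun x hx => dvd_iff_isRoot.2 ?_
    · exact fun x _ y _ hxy => isCoprime_X_sub_C_of_isUnit_sub (sub_ne_zero.2 hxy).isUnit
    · simp [IsRoot, h x hx]
  obtain ⟨r, hr⟩ := hdvd
  rw [← sub_eq_zero, ← map_sub, hr, map_mul, hs, zero_mul]

theorem orthogonalIdempotents_aeval_basis {b : W} {s : Finset ℝ}
    (hs : aeval b (Lagrange.nodal s id) = 0) :
    OrthogonalIdempotents fun x : s => aeval b (Lagrange.basis s id (x : ℝ)) := by
  have heval : ∀ x y : s, (Lagrange.basis s id (x : ℝ)).eval (y : ℝ) = if x = y then 1 else 0 := by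
    intro x y
    split_ifs with hxy
    · exact hxy ▸ Lagrange.eval_basis_self (v := id) Function.injective_id.injOn x.2
    · exact Lagrange.eval_basis_of_ne (v := id) (fun h => hxy (Subtype.ext h)) y.2
  refine OrthogonalIdempotents.iff_mul_eq.2 fun x y => ?_
  rw [← map_mul]
  split_ifs with hxy
  · refine aeval_eq_of_eval_eq hs fun z hz => ?_
    rw [eval_mul, heval x ⟨z, hz⟩, heval y ⟨z, hz⟩]
    simp [hxy]
  · rw [← map_zero (aeval (R := ℝ) b)]
    refine aeval_eq_of_eval_eq hs fun z hz => ?_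
    rw [eval_mul, heval x ⟨z, hz⟩, heval y ⟨z, hz⟩]
    simp only [eval_zero]
    grind

theorem eq_sum_smul_aeval_basis {b : W} {s : Finset ℝ}
    (hs : aeval b (Lagrange.nodal s id) = 0) :
    b = ∑ x : s, (x : ℝ) • aeval b (Lagrange.basis s id (x : ℝ)) := by
  calc b = aeval b (X : ℝ[X]) := (aeval_X b).symm
    _ = aeval b (Lagrange.interpolate s id id) := aeval_eq_of_eval_eq hs fun x hx => by
        simpa using (Lagrange.eval_interpolate_at_node (v := id) id
          Function.injective_id.injOn hx).symm
    _ = ∑ x ∈ s, x • aeval b (Lagrange.basis s id x) := by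
        simp [Lagrange.interpolate_apply, ← Algebra.smul_def]
    _ = _ := (Finset.sum_coe_sort s fun x => x • aeval b (Lagrange.basis s id x)).symm

variable [StarRing W] [StarModule ℝ W]

theorem star_aeval {b : W} (hb : star b = b) (p : ℝ[X]) : star (aeval b p) = aeval b p := by
  simp only [aeval_eq_sum_range, star_sum, star_smul, star_pow, hb, star_trivial]

variable [StarFormallyReal W]

theorem squarefree_minpoly {b : W} (hb : star b = b) (hint : IsIntegral ℝ b) :
    Squarefree (minpoly ℝ b) := by
  rintro p ⟨q, hq⟩
  have hpq : aeval b (p * q) = 0 := by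
    apply eq_zero_of_star_mul_self_eq_zero
    rw [star_aeval hb, ← map_mul, show p * q * (p * q) = p * p * q * q by ring, ← hq, map_mul,
      minpoly.aeval, zero_mul]
  have hne : p * q ≠ 0 := fun h => minpoly.ne_zero hint (by rw [hq, mul_assoc, h, mul_zero])
  have hdvd : p * (p * q) ∣ 1 * (p * q) := by
    rw [one_mul, ← mul_assoc, ← hq]
    exact minpoly.dvd ℝ b hpq
  exact isUnit_of_dvd_one ((mul_dvd_mul_iff_right hne).1 hdvd)

theorem im_eq_zero_of_aeval_minpoly_eq_zero {b : W} (hb : star b = b) (hint : IsIntegral ℝ b)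
    {z : ℂ} (hz : aeval z (minpoly ℝ b) = 0) : z.im = 0 := by
  by_contra him
  obtain ⟨k, hk⟩ := quadratic_dvd_of_aeval_eq_zero_im_ne_zero _ hz him
  -- The quadratic factor is the sum of squares `(X - z.re) ^ 2 + z.im ^ 2`, so it can be cancelled.
  have hquad : (X ^ 2 - C (2 * z.re) * X + C (‖z‖ ^ 2) : ℝ[X])
      = (X - C z.re) ^ 2 + C z.im ^ 2 := by
    rw [← Complex.normSq_eq_norm_sq, Complex.normSq_apply]
    simp only [map_mul, map_add, map_ofNat]
    ring
  have hk0 : aeval b (C z.im * k) = 0 := by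
    refine StarFormallyReal.eq_zero_of_add _ (aeval b ((X - C z.re) * k)) ?_
    rw [star_aeval hb, star_aeval hb, ← map_mul, ← map_mul, ← map_add,
      show C z.im * k * (C z.im * k) + (X - C z.re) * k * ((X - C z.re) * k)
        = ((X - C z.re) ^ 2 + C z.im ^ 2) * k * k by ring, ← hquad, ← hk, map_mul,
      minpoly.aeval, zero_mul]
  have hkdvd : minpoly ℝ b ∣ 1 * k := by
    have h := minpoly.dvd ℝ b hk0
    rwa [(isUnit_C.2 (Ne.isUnit him)).dvd_mul_left, ← one_mul k] at h
  have hk_ne : k ≠ 0 := fun h => minpoly.ne_zero hint (by rw [hk, h, mul_zero])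
  have hunit : IsUnit (X ^ 2 - C (2 * z.re) * X + C (‖z‖ ^ 2) : ℝ[X]) :=
    isUnit_of_dvd_one ((mul_dvd_mul_iff_right hk_ne).1 (hk ▸ hkdvd))
  have hdeg : (X ^ 2 - C (2 * z.re) * X + C (‖z‖ ^ 2) : ℝ[X]).degree = 2 := by compute_degree!
  rw [degree_eq_zero_of_isUnit hunit] at hdeg
  exact absurd hdeg (by decide)

theorem splits_minpoly {b : W} (hb : star b = b) (hint : IsIntegral ℝ b) :
    (minpoly ℝ b).Splits := by
  refine (IsAlgClosed.splits _).of_splits_map (algebraMap ℝ ℂ) fun z hz => ?_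
  have hroot : aeval z (minpoly ℝ b) = 0 := by
    simpa [IsRoot, aeval_def, eval_map] using isRoot_of_mem_roots hz
  exact ⟨z.re, Complex.ext rfl (im_eq_zero_of_aeval_minpoly_eq_zero hb hint hroot).symm⟩

theorem exists_aeval_nodal_eq_zero {b : W} (hb : star b = b) (hint : IsIntegral ℝ b) :
    ∃ s : Finset ℝ, aeval b (Lagrange.nodal s id) = 0 := by
  refine ⟨(minpoly ℝ b).roots.toFinset, ?_⟩
  have hsep := PerfectField.separable_iff_squarefree.2 (squarefree_minpoly hb hint)
  have hprod := (splits_minpoly hb hint).eq_prod_roots_of_monic (minpoly.monic hint)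
  rw [Lagrange.nodal_eq, Finset.prod, Multiset.toFinset_val, (nodup_roots hsep).dedup]
  simp only [id_eq, ← hprod, minpoly.aeval]

/-- The spectral decomposition of `b`; its idempotents are polynomials in `b`, hence lie in every
Jordan subspace that contains `b`. -/
theorem exists_orthogonalIdempotents_eq_sum_smul [FiniteDimensional ℝ W] {b : W}
    (hb : star b = b) :
    ∃ (s : Finset ℝ) (e : s → ℝ[X]), OrthogonalIdempotents (fun x => aeval b (e x)) ∧
      b = ∑ x : s, (x : ℝ) • aeval b (e x) := by
  obtain ⟨s, hs⟩ := exists_aeval_nodal_eq_zero hb (Algebra.IsIntegral.isIntegral b)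
  exact ⟨s, _, orthogonalIdempotents_aeval_basis hs, eq_sum_smul_aeval_basis hs⟩

end SpectralDecomposition

section JordanHom

theorem sum_smul_mul_sum_smul {R κ : Type*} [Ring R] [Algebra ℝ R] [Fintype κ] {e : κ → R}
    (he : OrthogonalIdempotents e) (c d : κ → ℝ) :
    (∑ x, c x • e x) * ∑ x, d x • e x = ∑ x, (c x * d x) • e x := by
  classical
  simp only [Finset.sum_mul_sum, smul_mul_smul_comm, he.mul_eq]
  simp

variable {W S : Type*} [Ring W] [StarRing W] [Algebra ℝ W] [Ring S] [Algebra ℝ S]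
  {A : Submodule ℝ W}

theorem map_mul_self_of_map_idempotent [StarModule ℝ W] [StarFormallyReal W]
    [FiniteDimensional ℝ W] (hA : IsJordanSubspace A) {g : A →ₗ[ℝ] S}
    (hg : ∀ p : A, IsIdempotentElem (p : W) → IsIdempotentElem (g p)) {a b : A}
    (hb : (b : W) = a * a) : g b = g a * g a := by
  obtain ⟨s, p, hp, hsum⟩ := exists_orthogonalIdempotents_eq_sum_smul (hA.star_eq a a.2)
  let e : s → A := fun x => ⟨_, hA.aeval_mem a.2 (p x)⟩
  have hge : OrthogonalIdempotents fun x => g (e x) := by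
    refine ⟨fun x => hg _ (hp.idem x), fun x y hxy => ?_⟩
    have hadd : IsIdempotentElem (g (e x + e y)) :=
      hg _ ((hp.idem x).add (hp.idem y) (by simp [e, hp.ortho hxy, hp.ortho hxy.symm]))
    rw [map_add, IsIdempotentElem.add_iff (hg _ (hp.idem x)) (hg _ (hp.idem y))] at hadd
    have : IsAddTorsionFree S := .of_isTorsionFree ℝ S
    exact (hg _ (hp.idem x)).mul_eq_zero_of_anticommute hadd
  have ha : a = ∑ x : s, (x : ℝ) • e x := Subtype.ext (by simpa [e] using hsum)
  have hb' : b = ∑ x : s, ((x : ℝ) * x) • e x := Subtype.ext <| by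
    rw [hb, hsum, sum_smul_mul_sum_smul hp]
    simp [e]
  rw [hb', ha, map_sum, map_sum]
  simpa using (sum_smul_mul_sum_smul hge _ _).symm

variable [StarRing S]

/-- A unital homomorphism of Jordan algebras from `A` into the self-adjoint elements of `S`. As `A`
is not closed under the associative product, its values are related through equations in `W`. -/
structure IsJordanHom (g : A →ₗ[ℝ] S) : Prop where
  map_one : ∀ a : A, (a : W) = 1 → g a = 1
  star_map : ∀ a, star (g a) = g a
  map_mul_add_mul : ∀ a b c : A, (c : W) = a * b + b * a → g c = g a * g b + g b * g a

theorem IsJordanHom.of_map_idempotent [StarModule ℝ W] [StarFormallyReal W]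
    [FiniteDimensional ℝ W] (hA : IsJordanSubspace A) {g : A →ₗ[ℝ] S}
    (map_one : ∀ a : A, (a : W) = 1 → g a = 1) (star_map : ∀ a, star (g a) = g a)
    (map_idem : ∀ p : A, IsIdempotentElem (p : W) → IsIdempotentElem (g p)) :
    IsJordanHom g := by
  refine ⟨map_one, star_map, fun a b c hc => ?_⟩
  let sq : A → A := fun a => ⟨_, hA.mul_self_mem a.2⟩
  have hsq : ∀ a, g (sq a) = g a * g a := fun a =>
    map_mul_self_of_map_idempotent hA map_idem rfl
  have hpolar : c = sq (a + b) - sq a - sq b := Subtype.ext <| by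
    simp only [sq, hc, Submodule.coe_add, Submodule.coe_sub]
    noncomm_ring
  rw [hpolar, map_sub, map_sub, hsq, hsq, hsq, map_add]
  noncomm_ring

end JordanHom

section Encoding

theorem exists_linearMap_of_convex {E F : Type*} [AddCommGroup E] [Module ℝ E] [AddCommGroup F]
    [Module ℝ F] {f : E → F} (h0 : f 0 = 0)
    (hf : ∀ a b, ∀ t : ℝ, 0 ≤ t → t ≤ 1 → f (t • a + (1 - t) • b) = t • f a + (1 - t) • f b) :
    ∃ g : E →ₗ[ℝ] F, ∀ a, g a = f a := by
  have hshrink : ∀ (t : ℝ) a, 0 ≤ t → t ≤ 1 → f (t • a) = t • f a := fun t a ht ht1 => by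
    simpa [h0] using hf a 0 t ht ht1
  have hscale : ∀ (t : ℝ) a, 0 ≤ t → f (t • a) = t • f a := fun t a ht => by
    rcases le_total t 1 with h | h
    · exact hshrink t a ht h
    · have hne : t ≠ 0 := by linarith
      have := hshrink t⁻¹ (t • a) (inv_nonneg.2 ht) (inv_le_one_of_one_le₀ h)
      rw [inv_smul_smul₀ hne] at this
      rw [this, smul_inv_smul₀ hne]
  have hadd : ∀ a b, f (a + b) = f a + f b := fun a b => by
    have h := hf ((2 : ℝ) • a) ((2 : ℝ) • b) (1 / 2) (by norm_num) (by norm_num)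
    rw [hscale 2 a zero_le_two, hscale 2 b zero_le_two] at h
    norm_num [smul_smul] at h
    exact h
  have hneg : ∀ a, f (-a) = -f a := fun a =>
    eq_neg_of_add_eq_zero_left (by rw [← hadd, neg_add_cancel, h0])
  refine ⟨{ toFun := f, map_add' := hadd, map_smul' := fun t a => ?_ }, fun a => rfl⟩
  rcases le_total 0 t with h | h
  · exact hscale t a h
  · have h' := hscale (-t) a (neg_nonneg.2 h)
    rwa [neg_smul, neg_smul, hneg, neg_inj] at h'

open scoped Matrix.Norms.L2Operator in
theorem MatAlg.isIdempotentElem_of_spectrum_subset {k : ℕ} {M : MatAlg k} (hM : IsSelfAdjoint M)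
    (h : spectrum ℂ M ⊆ {0, 1}) : IsIdempotentElem M :=
  (isIdempotentElem_iff_spectrum_subset ℂ M hM.isStarNormal).2 h

variable {n : ℕ} {ι : Type*} {m : ι → ℕ} {A : Submodule ℝ (MatAlg n)}
  {B : Submodule ℝ (SumMatAlg m)} {γ : A → B}

theorem IsEncoding.spectrum_apply_subset (hγ : IsEncoding γ) (a : A) (i : ι) :
    spectrum ℂ ((γ a : SumMatAlg m) i) ⊆ spectrum ℂ (a : MatAlg n) :=
  (hγ.spectrum_eq a) ▸
    AlgHom.spectrum_apply_subset (Pi.evalAlgHom ℂ (fun i => MatAlg (m i)) i) (γ a : SumMatAlg m)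

theorem IsEncoding.exists_isJordanHom (hA : IsJordanSubspace A) (hB : IsJordanSubspace B)
    (hγ : IsEncoding γ) (i : ι) :
    ∃ g : A →ₗ[ℝ] MatAlg (m i), IsJordanHom g ∧ ∀ a, g a = (γ a : SumMatAlg m) i := by
  have hstar : ∀ a, IsSelfAdjoint ((γ a : SumMatAlg m) i) := fun a =>
    congrFun (hB.star_eq _ (γ a).2) i
  have hzero : (γ 0 : SumMatAlg m) i = 0 := by
    open scoped Matrix.Norms.L2Operator in
    refine CFC.eq_zero_of_spectrum_subset_zero (R := ℂ) _ ?_ (hstar 0).isStarNormal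
    refine (hγ.spectrum_apply_subset 0 i).trans ?_
    rcases subsingleton_or_nontrivial (MatAlg n) with _ | _ <;> simp
  have hone : ∀ a : A, (a : MatAlg n) = 1 → (γ a : SumMatAlg m) i = 1 := fun a ha => by
    open scoped Matrix.Norms.L2Operator in
    refine CFC.eq_one_of_spectrum_subset_one (R := ℂ) _ ?_ (hstar a).isStarNormal
    refine (hγ.spectrum_apply_subset a i).trans ?_
    rcases subsingleton_or_nontrivial (MatAlg n) with _ | _ <;> simp [ha]
  obtain ⟨g, hg⟩ := exists_linearMap_of_convex (f := fun a => (γ a : SumMatAlg m) i) hzero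
    fun a b t ht ht1 => by simp [hγ.convex a b t ht ht1]
  refine ⟨g, IsJordanHom.of_map_idempotent hA (fun a ha => (hg a).trans (hone a ha))
    (fun a => by rw [hg]; exact hstar a) fun p hp => ?_, hg⟩
  rw [hg]
  exact MatAlg.isIdempotentElem_of_spectrum_subset (hstar p)
    ((hγ.spectrum_apply_subset p i).trans (hp.spectrum_subset ℂ))

end Encoding

section JordanFrame

variable {W : Type*} [Ring W] [Algebra ℝ W] {A : Submodule ℝ W}

/-- A minimal idempotent of `A`: a nonzero idempotent `p` with `p A p = ℝ p`. -/
structure IsMinimalIdempotent (A : Submodule ℝ W) (p : W) : Prop where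
  mem : p ∈ A
  idem : IsIdempotentElem p
  ne_zero : p ≠ 0
  exists_smul : ∀ a ∈ A, ∃ c : ℝ, p * a * p = c • p

theorem IsMinimalIdempotent.eq_of_smul_eq {p : W} (hp : IsMinimalIdempotent A p) {c d : ℝ}
    (h : c • p = d • p) : c = d :=
  smul_left_injective ℝ hp.ne_zero h

/-- A Jordan frame of `A`: a finite family of pairwise orthogonal minimal idempotents of sum `1`. -/
structure IsJordanFrame {I : Type*} [Fintype I] (A : Submodule ℝ W) (p : I → W) : Prop where
  minimal : ∀ i, IsMinimalIdempotent A (p i)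
  complete : CompleteOrthogonalIdempotents p

/-- The Peirce corner `e A e` of an idempotent `e` of `A`, described as the space of the `a` in `A`
on which `e` acts as a unit. -/
def peirceCorner (A : Submodule ℝ W) (e : W) : Submodule ℝ W where
  carrier := {a | a ∈ A ∧ e * a = a ∧ a * e = a}
  add_mem' := fun ha hb => ⟨A.add_mem ha.1 hb.1, by rw [mul_add, ha.2.1, hb.2.1],
    by rw [add_mul, ha.2.2, hb.2.2]⟩
  zero_mem' := ⟨A.zero_mem, mul_zero e, zero_mul e⟩
  smul_mem' := fun c a ha => ⟨A.smul_mem c ha.1, by rw [mul_smul_comm, ha.2.1],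
    by rw [smul_mul_assoc, ha.2.2]⟩

theorem peirceCorner_lt {e q : W} (he : e ∈ A) (hidem : IsIdempotentElem e)
    (hq : q ∈ peirceCorner A e) (hne : q ≠ e) : peirceCorner A q < peirceCorner A e := by
  refine lt_of_le_of_ne (fun a ha => ⟨ha.1, ?_, ?_⟩) fun h => hne ?_
  · rw [← ha.2.1, ← mul_assoc, hq.2.1]
  · rw [← ha.2.2, mul_assoc, hq.2.2]
  · have hmem : e ∈ peirceCorner A q := h ▸ ⟨he, hidem, hidem⟩
    exact hq.2.2.symm.trans hmem.2.1

theorem sub_mem_peirceCorner {e q : W} (he : e ∈ A) (hidem : IsIdempotentElem e)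
    (hq : q ∈ peirceCorner A e) : e - q ∈ peirceCorner A e :=
  (peirceCorner A e).sub_mem ⟨he, hidem, hidem⟩ hq

theorem isIdempotentElem_sub_of_mem_peirceCorner {e q : W} (hidem : IsIdempotentElem e)
    (hq : q ∈ peirceCorner A e) (hqq : IsIdempotentElem q) : IsIdempotentElem (e - q) := by
  rw [IsIdempotentElem, mul_sub, sub_mul, sub_mul, hidem.eq, hq.2.1, hq.2.2, hqq.eq, sub_self,
    sub_zero]

variable [StarRing W] [StarModule ℝ W] [StarFormallyReal W] [FiniteDimensional ℝ W]

namespace IsJordanSubspace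

theorem exists_idempotent_mem_peirceCorner (hA : IsJordanSubspace A) {e : W} (he : e ∈ A)
    (hidem : IsIdempotentElem e) (he0 : e ≠ 0) (hmin : ¬ IsMinimalIdempotent A e) :
    ∃ q ∈ peirceCorner A e, IsIdempotentElem q ∧ q ≠ 0 ∧ q ≠ e := by
  obtain ⟨a, ha, hne⟩ : ∃ a ∈ A, ∀ c : ℝ, e * a * e ≠ c • e := by
    by_contra! h
    exact hmin ⟨he, hidem, he0, h⟩
  have hb : e * a * e ∈ A := hA.mul_mul_mem he ha
  obtain ⟨s, p, hp, hsum⟩ := exists_orthogonalIdempotents_eq_sum_smul (hA.star_eq _ hb)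
  obtain ⟨x, hx⟩ : ∃ x : s, (x : ℝ) • Polynomial.aeval (e * a * e) (p x) ≠ 0 := by
    by_contra! h
    rw [Finset.sum_eq_zero fun x _ => h x] at hsum
    exact hne 0 (by rw [hsum, zero_smul])
  obtain ⟨hx0, hq0⟩ := smul_ne_zero_iff.1 hx
  set q := Polynomial.aeval (e * a * e) (p x)
  have hbq : e * a * e * q = (x : ℝ) • q := by
    conv_lhs => rw [hsum, Finset.sum_mul]
    rw [Finset.sum_eq_single x (fun y _ hy => by rw [smul_mul_assoc, hp.ortho hy, smul_zero])
      (fun h => absurd (Finset.mem_univ x) h), smul_mul_assoc, hp.idem x]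
  have hqb : q * (e * a * e) = (x : ℝ) • q := by
    rw [← hbq]
    simpa only [Polynomial.aeval_X] using
      ((Polynomial.commute_X (p x)).map (Polynomial.aeval (e * a * e))).eq.symm
  refine ⟨q, ⟨hA.aeval_mem hb _, ?_, ?_⟩, hp.idem x, hq0, fun h => hne x ?_⟩
  · rw [← inv_smul_smul₀ hx0 q, ← hbq, mul_smul_comm, ← mul_assoc, ← mul_assoc, ← mul_assoc,
      hidem.eq]
  · rw [← inv_smul_smul₀ hx0 q, ← hqb, smul_mul_assoc, mul_assoc, mul_assoc _ e e, hidem.eq]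
  · rwa [h, mul_assoc _ e e, hidem.eq] at hbq

theorem exists_isMinimalIdempotent_mem_peirceCorner (hA : IsJordanSubspace A) {e : W}
    (he : e ∈ A) (hidem : IsIdempotentElem e) (he0 : e ≠ 0) :
    ∃ f ∈ peirceCorner A e, IsMinimalIdempotent A f := by
  induction hC : peirceCorner A e using WellFoundedLT.induction generalizing e with
  | ind C ih =>
    subst hC
    by_cases hmin : IsMinimalIdempotent A e
    · exact ⟨e, ⟨he, hidem, hidem⟩, hmin⟩
    · obtain ⟨q, hq, hqq, hq0, hqe⟩ := hA.exists_idempotent_mem_peirceCorner he hidem he0 hmin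
      have hlt := peirceCorner_lt he hidem hq hqe
      obtain ⟨f, hf, hfmin⟩ := ih _ hlt hq.1 hqq hq0 rfl
      exact ⟨f, hlt.le hf, hfmin⟩

theorem exists_finset_sum_eq_of_idempotent (hA : IsJordanSubspace A) {e : W} (he : e ∈ A)
    (hidem : IsIdempotentElem e) :
    ∃ F : Finset W, (∀ f ∈ F, IsMinimalIdempotent A f ∧ f ∈ peirceCorner A e) ∧
      (F : Set W).Pairwise (fun f g => f * g = 0) ∧ ∑ f ∈ F, f = e := by
  classical
  induction hC : peirceCorner A e using WellFoundedLT.induction generalizing e with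
  | ind C ih =>
    subst hC
    rcases eq_or_ne e 0 with rfl | he0
    · exact ⟨∅, by simp⟩
    obtain ⟨f, hf, hfmin⟩ := hA.exists_isMinimalIdempotent_mem_peirceCorner he hidem he0
    have hsub := sub_mem_peirceCorner he hidem hf
    have hlt := peirceCorner_lt he hidem hsub fun h => hfmin.ne_zero (sub_eq_self.1 h)
    obtain ⟨F, hF, hortho, hsum⟩ := ih _ hlt hsub.1
      (isIdempotentElem_sub_of_mem_peirceCorner hidem hf hfmin.idem) rfl
    have hfg : ∀ g ∈ F, f * g = 0 := fun g hg => by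
      rw [← (hF g hg).2.2.1, ← mul_assoc, mul_sub, hf.2.2, hfmin.idem.eq, sub_self, zero_mul]
    have hgf : ∀ g ∈ F, g * f = 0 := fun g hg => by
      rw [← (hF g hg).2.2.2, mul_assoc, sub_mul, hf.2.1, hfmin.idem.eq, sub_self, mul_zero]
    have hfF : f ∉ F := fun h => hfmin.ne_zero (hfmin.idem.eq.symm.trans (hfg f h))
    refine ⟨insert f F, ?_, ?_, by rw [Finset.sum_insert hfF, hsum, add_sub_cancel]⟩
    · rw [Finset.forall_mem_insert]
      exact ⟨⟨hfmin, hf⟩, fun g hg => ⟨(hF g hg).1, hlt.le (hF g hg).2⟩⟩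
    · rw [Finset.coe_insert]
      exact hortho.insert fun g hg _ => ⟨hfg g hg, hgf g hg⟩

theorem exists_isJordanFrame (hA : IsJordanSubspace A) :
    ∃ F : Finset W, IsJordanFrame A (fun f : F => (f : W)) := by
  obtain ⟨F, hmin, hortho, hsum⟩ := hA.exists_finset_sum_eq_of_idempotent hA.one_mem .one
  exact ⟨F, fun f => (hmin f f.2).1, ⟨fun f => (hmin f f.2).1.idem,
    fun f g hne => hortho f.2 g.2 (Subtype.coe_injective.ne hne)⟩,
    (Finset.sum_coe_sort F fun f => f).trans hsum⟩

end IsJordanSubspace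

end JordanFrame

section SmallFrames

variable {W : Type*} [Ring W] [Algebra ℝ W] {A : Submodule ℝ W}

/-- The elements of `A` whose diagonal corners are opposite multiples of `p` and `q`. When
`p + q = 1` this is the complement `V` of `ℝ 1` in the spin factor `A`. -/
def traceless (A : Submodule ℝ W) (p q : W) : Submodule ℝ W where
  carrier := {a | a ∈ A ∧ ∃ s : ℝ, p * a * p = s • p ∧ q * a * q = (-s) • q}
  add_mem' := by
    rintro a b ⟨ha, s, hpa, hqa⟩ ⟨hb, t, hpb, hqb⟩
    refine ⟨A.add_mem ha hb, s + t, ?_, ?_⟩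
    · rw [mul_add, add_mul, hpa, hpb, add_smul]
    · rw [mul_add, add_mul, hqa, hqb, neg_add, add_smul]
  zero_mem' := ⟨A.zero_mem, 0, by simp, by simp⟩
  smul_mem' := by
    rintro c a ⟨ha, s, hpa, hqa⟩
    refine ⟨A.smul_mem c ha, c * s, ?_, ?_⟩
    · rw [mul_smul_comm, smul_mul_assoc, hpa, smul_smul]
    · rw [mul_smul_comm, smul_mul_assoc, hqa, smul_smul, mul_neg]

variable [StarRing W]

namespace IsMinimalIdempotent

theorem exists_peirce_smul (hA : IsJordanSubspace A) {p q a : W} (hp : IsMinimalIdempotent A p)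
    (hq : IsMinimalIdempotent A q) (ha : a ∈ A) :
    ∃ c : ℝ, p * a * q * a * p = c • p ∧ q * a * p * a * q = c • q := by
  obtain ⟨c, hc⟩ := hp.exists_smul _ (hA.mul_mul_mem ha hq.mem)
  obtain ⟨d, hd⟩ := hq.exists_smul _ (hA.mul_mul_mem ha hp.mem)
  simp only [← mul_assoc] at hc hd
  by_cases h0 : p * a * q = 0
  · have h0' : q * a * p = 0 := by
      simpa [hA.star_eq p hp.mem, hA.star_eq q hq.mem, hA.star_eq a ha, mul_assoc]
        using congrArg star h0
    exact ⟨0, by simp [h0], by simp [h0']⟩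
  · have hcd : c • (p * a * q) = d • (p * a * q) := calc
      c • (p * a * q) = p * a * q * a * p * a * q := by rw [hc]; simp only [smul_mul_assoc]
      _ = p * a * (q * a * p * a * q) := by simp only [mul_assoc]
      _ = d • (p * a * q) := by rw [hd, mul_smul_comm]
    exact ⟨c, hc, by rw [hd, smul_left_injective ℝ h0 hcd]⟩

theorem isSpinFactor_of_one (hA : IsJordanSubspace A) (h : IsMinimalIdempotent A (1 : W)) :
    IsSpinFactor A := by
  refine ⟨⊥, disjoint_bot_right, ?_, fun v hv => ⟨0, by simp [(Submodule.mem_bot ℝ).1 hv]⟩⟩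
  rw [sup_bot_eq]
  refine le_antisymm ((Submodule.span_singleton_le_iff_mem _ _).2 hA.one_mem) fun a ha => ?_
  obtain ⟨c, hc⟩ := h.exists_smul a ha
  rw [one_mul, mul_one] at hc
  exact Submodule.mem_span_singleton.2 ⟨c, hc.symm⟩

theorem exists_mul_self_eq_smul_one (hA : IsJordanSubspace A) {p q v : W}
    (hp : IsMinimalIdempotent A p) (hq : IsMinimalIdempotent A q) (h1 : p + q = 1)
    (hv : v ∈ traceless A p q) : ∃ c : ℝ, v * v = c • (1 : W) := by
  obtain ⟨hvA, s, hpv, hqv⟩ := hv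
  obtain ⟨c, hpc, hqc⟩ := hp.exists_peirce_smul hA hq hvA
  have hpp : p * v * p * v * p = (s * s) • p := by
    rw [hpv, smul_mul_assoc, smul_mul_assoc, hpv, smul_smul]
  have hqq : q * v * q * v * q = (s * s) • q := by
    rw [hqv, smul_mul_assoc, smul_mul_assoc, hqv, smul_smul, neg_mul_neg]
  have hpq : p * v * p * v * q + p * v * q * v * q = 0 := by
    rw [hpv, show p * v * q * v * q = p * v * (q * v * q) by simp only [mul_assoc], hqv]
    simp only [smul_mul_assoc, mul_smul_comm, neg_smul, mul_neg, add_neg_cancel]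
  have hqp : q * v * q * v * p + q * v * p * v * p = 0 := by
    rw [hqv, show q * v * p * v * p = q * v * (p * v * p) by simp only [mul_assoc], hpv]
    simp only [smul_mul_assoc, mul_smul_comm, neg_smul, neg_mul, neg_add_cancel]
  refine ⟨s * s + c, ?_⟩
  calc v * v = (p + q) * v * (p + q) * v * (p + q) := by rw [h1, one_mul, mul_one, mul_one]
    _ = p * v * p * v * p + p * v * q * v * p + (q * v * q * v * q + q * v * p * v * q)
        + (p * v * p * v * q + p * v * q * v * q)
        + (q * v * q * v * p + q * v * p * v * p) := by noncomm_ring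
    _ = (s * s + c) • (1 : W) := by
      rw [hpp, hqq, hpc, hqc, hpq, hqp, ← h1]
      module

theorem isSpinFactor_of_add_eq_one (hA : IsJordanSubspace A) {p q : W}
    (hp : IsMinimalIdempotent A p) (hq : IsMinimalIdempotent A q) (h1 : p + q = 1) :
    IsSpinFactor A := by
  refine ⟨traceless A p q, ?_, le_antisymm (sup_le ?_ fun x hx => hx.1) fun a ha => ?_,
    fun v hv => hp.exists_mul_self_eq_smul_one hA hq h1 hv⟩
  · rw [Submodule.disjoint_def]
    rintro x hx ⟨-, s, hpx, hqx⟩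
    obtain ⟨c, rfl⟩ := Submodule.mem_span_singleton.1 hx
    rw [mul_smul_comm, mul_one, smul_mul_assoc, hp.idem.eq] at hpx
    rw [mul_smul_comm, mul_one, smul_mul_assoc, hq.idem.eq] at hqx
    rw [show c = 0 by linarith [hp.eq_of_smul_eq hpx, hq.eq_of_smul_eq hqx], zero_smul]
  · exact (Submodule.span_singleton_le_iff_mem _ _).2 hA.one_mem
  · obtain ⟨s, hs⟩ := hp.exists_smul a ha
    obtain ⟨t, ht⟩ := hq.exists_smul a ha
    rw [← add_sub_cancel (((s + t) / 2) • (1 : W)) a]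
    refine Submodule.add_mem_sup (Submodule.mem_span_singleton.2 ⟨_, rfl⟩)
      ⟨A.sub_mem ha (A.smul_mem _ hA.one_mem), (s - t) / 2, ?_, ?_⟩
    · rw [mul_sub, sub_mul, mul_smul_comm, mul_one, smul_mul_assoc, hs, hp.idem.eq]
      module
    · rw [mul_sub, sub_mul, mul_smul_comm, mul_one, smul_mul_assoc, ht, hq.idem.eq]
      module

end IsMinimalIdempotent

end SmallFrames

section Connected

variable {W : Type*} [Ring W] [StarRing W] [Algebra ℝ W] {A : Submodule ℝ W}

theorem IsMinimalIdempotent.exists_mul_mul_ne_zero_trans [StarFormallyReal W]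
    (hA : IsJordanSubspace A) {p q r x a : W} (hp : IsMinimalIdempotent A p)
    (hq : IsMinimalIdempotent A q) (hr : IsMinimalIdempotent A r) (hpq : p * q = 0)
    (hpr : p * r = 0) (hqr : q * r = 0) (hx : x ∈ A) (ha : a ∈ A) (hpxq : p * x * q ≠ 0)
    (hqar : q * a * r ≠ 0) : ∃ y ∈ A, p * y * r ≠ 0 := by
  refine ⟨_, hA.mul_add_mul_mem _ (hA.triple_mem hp.mem hx hq.mem) _
    (hA.triple_mem hq.mem ha hr.mem), fun h0 => ?_⟩
  obtain ⟨c, -, hc⟩ := hp.exists_peirce_smul hA hq hx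
  have hc0 : c ≠ 0 := by
    rintro rfl
    refine hpxq (eq_zero_of_star_mul_self_eq_zero ?_)
    calc star (p * x * q) * (p * x * q) = q * x * (p * p) * x * q := by
          simp only [star_mul, hA.star_eq x hx, hA.star_eq p hp.mem, hA.star_eq q hq.mem, mul_assoc]
      _ = 0 := by rw [hp.idem.eq, hc, zero_smul]
  have hleft : p * (p * x * q + q * x * p) = p * x * q := by
    simp only [mul_add, ← mul_assoc, hp.idem.eq, hpq, zero_mul, add_zero]
  have hright : (q * a * r + r * a * q) * r = q * a * r := by
    simp only [add_mul, mul_assoc, hr.idem.eq, hqr, mul_zero, add_zero]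
  have hannihil : p * (q * a * r + r * a * q) = 0 := by
    simp only [mul_add, ← mul_assoc, hpq, hpr, zero_mul, add_zero]
  have hpath : p * x * q * (q * a * r) = 0 := by
    set X := p * x * q + q * x * p
    set Y := q * a * r + r * a * q
    calc p * x * q * (q * a * r) = p * X * (Y * r) := by rw [hleft, hright]
      _ = p * (X * Y + Y * X) * r - p * Y * X * r := by noncomm_ring
      _ = 0 := by rw [h0, hannihil, zero_mul, zero_mul, sub_zero]
  have hsmul : c • (q * a * r) = 0 := calc
    c • (q * a * r) = q * x * p * x * q * (a * r) := by
      rw [hc, smul_mul_assoc, mul_assoc q a r]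
    _ = q * x * (p * x * (q * q) * a * r) := by rw [hq.idem.eq]; simp only [mul_assoc]
    _ = q * x * (p * x * q * (q * a * r)) := by simp only [mul_assoc]
    _ = 0 := by rw [hpath, mul_zero]
  exact hqar ((smul_eq_zero.1 hsmul).resolve_left hc0)

theorem IsSimpleJordan.eq_zero_or_eq_one_of_mul_eq (hA : IsJordanSubspace A)
    (hsimple : IsSimpleJordan A) {e : W} (he : e ∈ A) (hidem : IsIdempotentElem e)
    (hinv : ∀ a ∈ A, e * a = e * a * e) : e = 0 ∨ e = 1 := by
  have hinv' : ∀ a ∈ A, a * e = e * a * e := fun a ha => by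
    simpa only [star_mul, hA.star_eq a ha, hA.star_eq e he, mul_assoc]
      using congrArg star (hinv a ha)
  have hcomm : ∀ a ∈ A, e * a = a * e := fun a ha => (hinv a ha).trans (hinv' a ha).symm
  have hI := hsimple.2 (peirceCorner A e) (fun x hx => hx.1) fun a ha x hx => by
    refine Submodule.smul_mem _ _ ⟨hA.mul_add_mul_mem a ha x hx.1, ?_, ?_⟩
    · rw [mul_add, ← mul_assoc, ← mul_assoc, hx.2.1, hcomm a ha, mul_assoc, hx.2.1]
    · rw [add_mul, mul_assoc, mul_assoc, hx.2.2, ← hcomm a ha, ← mul_assoc, hx.2.2]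
  rcases hI with h | h
  · exact .inl ((Submodule.mem_bot ℝ).1 (h ▸ ⟨he, hidem, hidem⟩))
  · have hone : (1 : W) ∈ peirceCorner A e := by rw [h]; exact hA.one_mem
    exact .inr ((mul_one e).symm.trans hone.2.1)

theorem IsJordanFrame.exists_mul_mul_ne_zero [StarFormallyReal W] (hA : IsJordanSubspace A)
    (hsimple : IsSimpleJordan A) {I : Type*} [Fintype I] {p : I → W}
    (hp : IsJordanFrame A p) (o k : I) : ∃ a ∈ A, p o * a * p k ≠ 0 := by
  classical
  have hortho := hp.complete.toOrthogonalIdempotents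
  set C : Finset I := {j | ∃ a ∈ A, p o * a * p j ≠ 0} with hC
  suffices hk : k ∈ C by simpa [hC] using hk
  have hoC : o ∈ C := by
    simp only [hC, Finset.mem_filter, Finset.mem_univ, true_and]
    exact ⟨1, hA.one_mem, by rw [mul_one, (hp.minimal o).idem.eq]; exact (hp.minimal o).ne_zero⟩
  have hclosed : ∀ j ∈ C, ∀ l ∉ C, ∀ a ∈ A, p j * a * p l = 0 := by
    intro j hj l hl a ha
    by_contra hne
    obtain ⟨x, hx, hxj⟩ := (Finset.mem_filter.1 hj).2
    have hol : o ≠ l := fun h => hl (h ▸ hoC)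
    have hjl : j ≠ l := fun h => hl (h ▸ hj)
    refine hl (Finset.mem_filter.2 ⟨Finset.mem_univ l, ?_⟩)
    rcases eq_or_ne o j with rfl | hoj
    · exact ⟨a, ha, hne⟩
    · exact (hp.minimal o).exists_mul_mul_ne_zero_trans hA (hp.minimal j) (hp.minimal l)
        (hortho.ortho hoj) (hortho.ortho hol) (hortho.ortho hjl) hx ha hxj hne
  have hinv : ∀ a ∈ A, (∑ j ∈ C, p j) * a = (∑ j ∈ C, p j) * a * ∑ j ∈ C, p j := fun a ha => by
    have hzero : (∑ j ∈ C, p j) * a * ∑ l ∈ Cᶜ, p l = 0 := by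
      rw [Finset.sum_mul, Finset.sum_mul_sum]
      exact Finset.sum_eq_zero fun j hj => Finset.sum_eq_zero fun l hl =>
        hclosed j hj l (Finset.mem_compl.1 hl) a ha
    rw [← add_zero (_ * _ * ∑ j ∈ C, p j), ← hzero, ← mul_add, Finset.sum_add_sum_compl,
      hp.complete.complete, mul_one]
  rcases hsimple.eq_zero_or_eq_one_of_mul_eq hA (A.sum_mem fun j _ => (hp.minimal j).mem)
    hortho.isIdempotentElem_sum hinv with h | h
  · have ho := hortho.mul_sum_of_mem hoC
    rw [h, mul_zero] at ho
    exact absurd ho.symm (hp.minimal o).ne_zero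
  · by_contra hk
    have hk' := hortho.mul_sum_of_notMem hk
    rw [h, mul_one] at hk'
    exact (hp.minimal k).ne_zero hk'

end Connected

section MatrixUnits

/-- Twice the Hermitian part of the matrix with entry `d` at `(i, j)` and zeros elsewhere, with
respect to the matrix units whose first row is `u`. -/
def hermUnit {W I : Type*} [Ring W] [StarRing W] (u : I → W) (i j : I) (d : W) : W :=
  star (u i) * d * u j + star (u j) * star d * u i

variable {W : Type*} [Ring W] [StarRing W] [Algebra ℝ W] {A : Submodule ℝ W}

theorem IsMinimalIdempotent.exists_partialIsometry [StarModule ℝ W] [StarFormallyReal W]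
    (hA : IsJordanSubspace A) {p q a : W} (hp : IsMinimalIdempotent A p)
    (hq : IsMinimalIdempotent A q) (ha : a ∈ A) (hne : p * a * q ≠ 0) :
    ∃ u : W, p * u = u ∧ u * q = u ∧ u * star u = p ∧ star u * u = q ∧ u + star u ∈ A := by
  obtain ⟨c, hpc, hqc⟩ := hp.exists_peirce_smul hA hq ha
  have hstar : star (p * a * q) = q * a * p := by
    rw [star_mul, star_mul, hA.star_eq p hp.mem, hA.star_eq q hq.mem, hA.star_eq a ha, mul_assoc]
  have hpc' : p * a * q * (q * a * p) = c • p := by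
    rw [← hpc]
    conv_rhs => rw [← hq.idem.eq]
    simp only [mul_assoc]
  have hqc' : q * a * p * (p * a * q) = c • q := by
    rw [← hqc]
    conv_rhs => rw [← hp.idem.eq]
    simp only [mul_assoc]
  have hc : 0 < c := by
    by_contra hc
    refine hne (StarFormallyReal.eq_zero_of_add _ (√(-c) • q) ?_)
    rw [hstar, hqc', star_smul, hA.star_eq q hq.mem, star_trivial, smul_mul_smul_comm, hq.idem.eq,
      Real.mul_self_sqrt (by linarith), ← add_smul, add_neg_cancel, zero_smul]
  have hscale : (√c)⁻¹ * (√c)⁻¹ * c = 1 := by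
    rw [← mul_inv, Real.mul_self_sqrt hc.le, inv_mul_cancel₀ hc.ne']
  refine ⟨(√c)⁻¹ • (p * a * q), ?_, ?_, ?_, ?_, ?_⟩
  · rw [mul_smul_comm, ← mul_assoc, ← mul_assoc, hp.idem.eq]
  · rw [smul_mul_assoc, mul_assoc _ q, hq.idem.eq]
  · rw [star_smul, hstar, star_trivial, smul_mul_smul_comm, hpc', smul_smul, hscale, one_smul]
  · rw [star_smul, hstar, star_trivial, smul_mul_smul_comm, hqc', smul_smul, hscale, one_smul]
  · rw [star_smul, hstar, star_trivial, ← smul_add]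
    exact A.smul_mem _ (hA.triple_mem hp.mem ha hq.mem)

variable {I : Type*} [Fintype I]

/-- The first row `u` of a system of matrix units `star (u i) * u j`, whose diagonal members are
minimal idempotents of `A` and whose off-diagonal members have their Hermitian parts in `A`. -/
structure IsMatrixRow (A : Submodule ℝ W) (p : W) (u : I → W) : Prop where
  minimal : IsMinimalIdempotent A p
  minimal_star_mul : ∀ i, IsMinimalIdempotent A (star (u i) * u i)
  mul_star_self : ∀ i, u i * star (u i) = p
  mul_star : ∀ i j, i ≠ j → u i * star (u j) = 0
  sum_star_mul : ∑ i, star (u i) * u i = 1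
  left_mul : ∀ i, p * u i = u i
  hermUnit_mem : ∀ i j, i ≠ j → hermUnit u i j p ∈ A

theorem IsJordanFrame.exists_isMatrixRow [StarModule ℝ W] [StarFormallyReal W]
    (hA : IsJordanSubspace A) (hsimple : IsSimpleJordan A) {p : I → W} (hp : IsJordanFrame A p)
    (o : I) : ∃ u : I → W, IsMatrixRow A (p o) u := by
  have hps := fun i => hA.star_eq _ (hp.minimal i).mem
  have hentry : ∀ j, ∃ u : W, p o * u = u ∧ u * p j = u ∧ u * star u = p o ∧ star u * u = p j ∧
      u + star u ∈ A ∧ (j = o → u = p o) := fun j => by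
    rcases eq_or_ne j o with rfl | hj
    · have hidem := (hp.minimal j).idem.eq
      exact ⟨p j, by simp [hidem, hps, A.add_mem (hp.minimal j).mem (hp.minimal j).mem]⟩
    · obtain ⟨a, ha, hne⟩ := hp.exists_mul_mul_ne_zero hA hsimple o j
      obtain ⟨u, hu⟩ := (hp.minimal o).exists_partialIsometry hA (hp.minimal j) ha hne
      exact ⟨u, by simpa [hj] using hu⟩
  choose u hleft hright hmul_star hstar_mul hmem ho using hentry
  have hmul_star_ne : ∀ i j, i ≠ j → u i * star (u j) = 0 := fun i j hij => by
    rw [← hright i, ← hright j, star_mul, hps, mul_assoc, ← mul_assoc (p i),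
      hp.complete.ortho hij, zero_mul, mul_zero]
  have hstar_right : ∀ i, star (u i) * p o = star (u i) := fun i => by
    rw [← hps o, ← star_mul, hleft]
  refine ⟨u, hp.minimal o, fun i => (hstar_mul i).symm ▸ hp.minimal i, hmul_star, hmul_star_ne,
    by simp only [hstar_mul, hp.complete.complete], hleft, fun i j hij => ?_⟩
  rw [hermUnit, hps, hstar_right, hstar_right]
  rcases eq_or_ne i o with hi | hi
  · rw [ho i hi, hps, hleft, hstar_right]
    exact hmem j
  rcases eq_or_ne j o with hj | hj
  · rw [ho j hj, hps, hleft, hstar_right, add_comm]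
    exact hmem i
  have hmul_ne : ∀ i j, i ≠ o → u i * u j = 0 := fun i j hi => by
    rw [← hright i, ← hleft j, mul_assoc, ← mul_assoc (p i), hp.complete.ortho hi, zero_mul,
      mul_zero]
  have hstar_ne : ∀ i j, j ≠ o → star (u i) * star (u j) = 0 := fun i j hj => by
    rw [← star_mul, hmul_ne j i hj, star_zero]
  simpa only [add_mul, mul_add, hmul_ne i j hi, hstar_ne i j hj, hmul_ne j i hj, hstar_ne j i hi,
    hmul_star_ne i j hij, hmul_star_ne j i hij.symm, zero_add, add_zero]
    using hA.mul_add_mul_mem _ (hmem i) _ (hmem j)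

namespace IsMatrixRow

variable {p : W} {u : I → W} (hu : IsMatrixRow A p u)
include hu

theorem mul_star_assoc {i j : I} (hij : i ≠ j) (x : W) : u i * (star (u j) * x) = 0 := by
  rw [← mul_assoc, hu.mul_star i j hij, zero_mul]

theorem mul_star_self_assoc (i : I) (x : W) : u i * (star (u i) * x) = p * x := by
  rw [← mul_assoc, hu.mul_star_self i]

theorem star_mul_right (hA : IsJordanSubspace A) (i : I) : star (u i) * p = star (u i) := by
  rw [← hA.star_eq p hu.minimal.mem, ← star_mul, hu.left_mul]

theorem hermUnit_mul_add_mul (hA : IsJordanSubspace A) {i j k : I} (hij : i ≠ j) (hjk : j ≠ k)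
    (hik : i ≠ k) (d f : W) :
    hermUnit u i j d * hermUnit u j k f + hermUnit u j k f * hermUnit u i j d
      = hermUnit u i k (d * p * f) := by
  simp only [hermUnit, add_mul, mul_add, mul_assoc, star_mul, hA.star_eq p hu.minimal.mem,
    hu.mul_star_assoc hij, hu.mul_star_assoc hij.symm, hu.mul_star_assoc hik,
    hu.mul_star_assoc hik.symm, hu.mul_star_assoc hjk, hu.mul_star_assoc hjk.symm,
    hu.mul_star_self_assoc, mul_zero, zero_add, add_zero]

theorem hermUnit_mul_add_mul_swap (hA : IsJordanSubspace A) {i j : I} (hij : i ≠ j) (d f : W) :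
    hermUnit u i j d * hermUnit u j i f + hermUnit u j i f * hermUnit u i j d
      = hermUnit u i i (d * p * f) + hermUnit u j j (f * p * d) := by
  simp only [hermUnit, add_mul, mul_add, mul_assoc, star_mul, hA.star_eq p hu.minimal.mem,
    hu.mul_star_assoc hij, hu.mul_star_assoc hij.symm,
    hu.mul_star_self_assoc, mul_zero, zero_add, add_zero]
  abel

theorem compress_hermUnit (hA : IsJordanSubspace A) {i j : I} (hij : i ≠ j) (d f : W) :
    star (u i) * u i * (hermUnit u i i d + hermUnit u j j f) * (star (u i) * u i)
      = hermUnit u i i d := by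
  have hstar : ∀ x, star (u i) * (p * x) = star (u i) * x := fun x => by
    rw [← mul_assoc, hu.star_mul_right hA]
  simp only [hermUnit, add_mul, mul_add, mul_assoc, hu.mul_star_assoc hij,
    hu.mul_star_self_assoc, hu.left_mul, hstar, mul_zero, add_zero]

/-- A Jordan algebra in matrix form of size at least three moves a coordinate to every position:
`hermUnit u i k d` is the Jordan product of `hermUnit u i j d` and `hermUnit u j k p`. -/
theorem hermUnit_mem_of_hermUnit_mem (hA : IsJordanSubspace A) (h3 : 3 ≤ ENat.card I) {d : W}
    (hpd : p * d = d) (hdp : d * p = d) {i j : I} (hij : i ≠ j) (h : hermUnit u i j d ∈ A)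
    (k l : I) : hermUnit u k l d ∈ A := by
  have hright : ∀ {i j k}, i ≠ j → i ≠ k → hermUnit u i j d ∈ A → hermUnit u i k d ∈ A := by
    intro i j k hij hik h
    rcases eq_or_ne j k with rfl | hjk
    · exact h
    · simpa only [hu.hermUnit_mul_add_mul hA hij hjk hik, hdp]
        using hA.mul_add_mul_mem _ h _ (hu.hermUnit_mem j k hjk)
  have hleft : ∀ {i j k}, i ≠ j → k ≠ j → hermUnit u i j d ∈ A → hermUnit u k j d ∈ A := by
    intro i j k hij hkj h
    rcases eq_or_ne k i with rfl | hki
    · exact h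
    · simpa only [hu.hermUnit_mul_add_mul hA hki hij hkj, hu.minimal.idem.eq, hpd]
        using hA.mul_add_mul_mem _ (hu.hermUnit_mem k i hki) _ h
  have hoff : ∀ {k l}, k ≠ l → hermUnit u k l d ∈ A := by
    intro k l hkl
    obtain ⟨m, hmi, hmk⟩ := ENat.exists_ne_ne_of_three_le h3 i k
    exact hright hmk.symm hkl (hleft hmi.symm hmk.symm (hright hij hmi.symm h))
  rcases eq_or_ne k l with rfl | hkl
  · obtain ⟨m, hmk, -⟩ := ENat.exists_ne_ne_of_three_le h3 k k
    have hsum := hA.mul_add_mul_mem _ (hoff hmk.symm) _ (hu.hermUnit_mem m k hmk)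
    rw [hu.hermUnit_mul_add_mul_swap hA hmk.symm] at hsum
    simpa only [hu.compress_hermUnit hA hmk.symm, hdp]
      using hA.mul_mul_mem (hu.minimal_star_mul k).mem hsum
  · exact hoff hkl

end IsMatrixRow

end MatrixUnits

section Coordinates

variable {W : Type*} [Ring W] [StarRing W] [Algebra ℝ W] {A : Submodule ℝ W} {I : Type*}
  {p : W} {u : I → W}

/-- Membership in the coordinate algebra of `A` with respect to the row `u` of matrix units: the
`d` in the corner of `p` that may stand at any position of an element of `A`. -/
structure IsJordanCoordinate (A : Submodule ℝ W) (p : W) (u : I → W) (d : W) : Prop where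
  left_mul : p * d = d
  right_mul : d * p = d
  hermUnit_mem : ∀ i j, hermUnit u i j d ∈ A

theorem IsJordanCoordinate.add {d f : W} (hd : IsJordanCoordinate A p u d)
    (hf : IsJordanCoordinate A p u f) : IsJordanCoordinate A p u (d + f) := by
  refine ⟨by rw [mul_add, hd.1, hf.1], by rw [add_mul, hd.2, hf.2], fun i j => ?_⟩
  convert A.add_mem (hd.hermUnit_mem i j) (hf.hermUnit_mem i j) using 1
  simp only [hermUnit, star_add]
  noncomm_ring

theorem IsJordanCoordinate.smul [StarModule ℝ W] (c : ℝ) {d : W}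
    (hd : IsJordanCoordinate A p u d) : IsJordanCoordinate A p u (c • d) := by
  refine ⟨by rw [mul_smul_comm, hd.1], by rw [smul_mul_assoc, hd.2], fun i j => ?_⟩
  convert A.smul_mem c (hd.hermUnit_mem i j) using 1
  simp only [hermUnit, star_smul, star_trivial c, mul_smul_comm, smul_mul_assoc, smul_add]

variable [Fintype I]

namespace IsMatrixRow

variable (hu : IsMatrixRow A p u)
include hu

theorem isJordanCoordinate_self (hA : IsJordanSubspace A) (h3 : 3 ≤ ENat.card I) (i : I) :
    IsJordanCoordinate A p u p := by
  obtain ⟨j, hj, -⟩ := ENat.exists_ne_ne_of_three_le h3 i i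
  have hp := hu.minimal.idem.eq
  exact ⟨hp, hp, hu.hermUnit_mem_of_hermUnit_mem hA h3 hp hp hj (hu.hermUnit_mem j i hj)⟩

theorem isJordanCoordinate_mul (hA : IsJordanSubspace A) (h3 : 3 ≤ ENat.card I) (i : I) {d f : W}
    (hd : IsJordanCoordinate A p u d) (hf : IsJordanCoordinate A p u f) :
    IsJordanCoordinate A p u (d * f) := by
  obtain ⟨j, hji, -⟩ := ENat.exists_ne_ne_of_three_le h3 i i
  obtain ⟨k, hki, hkj⟩ := ENat.exists_ne_ne_of_three_le h3 i j
  have hleft : p * (d * f) = d * f := by rw [← mul_assoc, hd.left_mul]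
  have hright : d * f * p = d * f := by rw [mul_assoc, hf.right_mul]
  refine ⟨hleft, hright, hu.hermUnit_mem_of_hermUnit_mem hA h3 hleft hright hji ?_⟩
  simpa only [hu.hermUnit_mul_add_mul hA hkj.symm hki hji, hd.right_mul]
    using hA.mul_add_mul_mem _ (hd.hermUnit_mem j k) _ (hf.hermUnit_mem k i)

variable [StarModule ℝ W]

theorem isJordanCoordinate_of_mem (hA : IsJordanSubspace A) (h3 : 3 ≤ ENat.card I) {a : W}
    (ha : a ∈ A) (i j : I) : IsJordanCoordinate A p u (u i * a * star (u j)) := by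
  have hr := hu.star_mul_right hA
  rcases eq_or_ne i j with rfl | hij
  · obtain ⟨c, hc⟩ := (hu.minimal_star_mul i).exists_smul a ha
    have hcorner : u i * a * star (u i) = c • p := calc
      u i * a * star (u i) = p * u i * a * (star (u i) * p) := by rw [hu.left_mul, hr]
      _ = u i * (star (u i) * u i * a * (star (u i) * u i)) * star (u i) := by
        rw [← hu.mul_star_self i]
        simp only [mul_assoc]
      _ = c • p := by
        rw [hc, mul_smul_comm, smul_mul_assoc, mul_assoc, mul_assoc, hu.mul_star_self, hr,
          hu.mul_star_self]
    exact hcorner ▸ (hu.isJordanCoordinate_self hA h3 i).smul c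
  · have hleft : p * (u i * a * star (u j)) = u i * a * star (u j) := by
      rw [← mul_assoc, ← mul_assoc, hu.left_mul]
    have hright : u i * a * star (u j) * p = u i * a * star (u j) := by rw [mul_assoc, hr]
    refine ⟨hleft, hright, hu.hermUnit_mem_of_hermUnit_mem hA h3 hleft hright hij ?_⟩
    simpa only [hermUnit, star_mul, star_star, hA.star_eq a ha, mul_assoc]
      using hA.triple_mem (hu.minimal_star_mul i).mem ha (hu.minimal_star_mul j).mem

/-- The elements all of whose matrix coordinates lie in the coordinate algebra of `A`. It is an
associative algebra containing `A`, and its self-adjoint elements lie in `A`. -/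
def coordinateSubalgebra (hA : IsJordanSubspace A) (h3 : 3 ≤ ENat.card I) : Subalgebra ℝ W where
  carrier := {z | ∀ i j, IsJordanCoordinate A p u (u i * z * star (u j))}
  add_mem' := fun hx hy i j => by
    rw [mul_add, add_mul]
    exact (hx i j).add (hy i j)
  mul_mem' := fun {x y} hx hy i j => by
    have hexpand : u i * (x * y) * star (u j)
        = ∑ k, (u i * x * star (u k)) * (u k * y * star (u j)) := by
      calc u i * (x * y) * star (u j) = u i * x * 1 * y * star (u j) := by
            simp only [mul_assoc, one_mul]
        _ = _ := by
            rw [← hu.sum_star_mul, Finset.mul_sum, Finset.sum_mul, Finset.sum_mul]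
            simp only [mul_assoc]
    rw [hexpand]
    refine Finset.sum_induction _ (IsJordanCoordinate A p u) (fun _ _ => IsJordanCoordinate.add)
      ?_ fun k _ => hu.isJordanCoordinate_mul hA h3 i (hx i k) (hy k j)
    simpa only [zero_smul] using (hu.isJordanCoordinate_self hA h3 i).smul 0
  algebraMap_mem' := fun c i j => by
    rw [Algebra.algebraMap_eq_smul_one]
    exact hu.isJordanCoordinate_of_mem hA h3 (A.smul_mem c hA.one_mem) i j

theorem mem_of_mem_adjoin (hA : IsJordanSubspace A) (h3 : 3 ≤ ENat.card I) {z : W}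
    (hz : z ∈ Algebra.adjoin ℝ (A : Set W)) (hs : star z = z) : z ∈ A := by
  have hle : Algebra.adjoin ℝ (A : Set W) ≤ hu.coordinateSubalgebra hA h3 :=
    Algebra.adjoin_le fun a ha => hu.isJordanCoordinate_of_mem hA h3 ha
  have hcoord : ∀ i j, IsJordanCoordinate A p u (u i * z * star (u j)) := hle hz
  have hexpand : z = ∑ i, ∑ j, star (u i) * (u i * z * star (u j)) * u j := calc
    z = 1 * z * 1 := by rw [one_mul, mul_one]
    _ = _ := by
      rw [← hu.sum_star_mul, Finset.sum_mul, Finset.sum_mul_sum]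
      simp only [mul_assoc]
  have hherm : z + z = ∑ i, ∑ j, hermUnit u i j (u i * z * star (u j)) := by
    simp only [hermUnit, Finset.sum_add_distrib]
    rw [← hexpand, Finset.sum_comm]
    simp only [star_mul, star_star, hs, ← mul_assoc] at hexpand ⊢
    rw [← hexpand]
  refine mem_of_add_self_mem ?_
  rw [hherm]
  exact A.sum_mem fun i _ => A.sum_mem fun j _ => (hcoord i j).hermUnit_mem i j

end IsMatrixRow

theorem IsJordanFrame.isSpinFactor_of_card_lt_three [Nontrivial W] (hA : IsJordanSubspace A)
    {F : Finset W} (hF : IsJordanFrame A (fun f : F => (f : W))) (hcard : F.card < 3) :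
    IsSpinFactor A := by
  have hsum : ∑ f ∈ F, f = 1 := (Finset.sum_coe_sort F id).symm.trans hF.complete.complete
  have h012 : F.card = 0 ∨ F.card = 1 ∨ F.card = 2 := by omega
  rcases h012 with h | h | h
  · simp [Finset.card_eq_zero.1 h] at hsum
  · obtain ⟨f, rfl⟩ := Finset.card_eq_one.1 h
    rw [Finset.sum_singleton] at hsum
    exact (hsum ▸ hF.minimal ⟨f, by simp⟩ : IsMinimalIdempotent A 1).isSpinFactor_of_one hA
  · classical
    obtain ⟨f, g, hfg, rfl⟩ := Finset.card_eq_two.1 h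
    rw [Finset.sum_pair hfg] at hsum
    exact (hF.minimal ⟨f, by simp⟩).isSpinFactor_of_add_eq_one hA (hF.minimal ⟨g, by simp⟩) hsum

theorem IsJordanSubspace.mem_of_mem_adjoin [StarModule ℝ W] [StarFormallyReal W]
    [FiniteDimensional ℝ W] [Nontrivial W] (hA : IsJordanSubspace A) (hsimple : IsSimpleJordan A)
    (hspin : ¬ IsSpinFactor A) {z : W} (hz : z ∈ Algebra.adjoin ℝ (A : Set W))
    (hs : star z = z) : z ∈ A := by
  obtain ⟨F, hF⟩ := hA.exists_isJordanFrame
  have hcard : 3 ≤ F.card := by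
    by_contra! h
    exact hspin (hF.isSpinFactor_of_card_lt_three hA h)
  obtain ⟨o, ho⟩ := Finset.card_pos.1 (by omega : 0 < F.card)
  obtain ⟨u, hu⟩ := hF.exists_isMatrixRow hA hsimple ⟨o, ho⟩
  exact hu.mem_of_mem_adjoin hA (by simpa using hcard) hz hs

end Coordinates

section InjectiveOnJordanSubspace

variable {W R : Type*} [Ring W] [Algebra ℝ W] [Ring R] [Algebra ℝ R] {G : Submodule ℝ W}
  {f : W →ₐ[ℝ] R}

theorem IsSimpleJordan.of_map (hf : Set.InjOn f G) (h : IsSimpleJordan (G.map f.toLinearMap)) :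
    IsSimpleJordan G := by
  refine ⟨fun hG => h.1 (by rw [hG, Submodule.map_bot]), fun I hI hmul => ?_⟩
  have hideal : ∀ a ∈ G.map f.toLinearMap, ∀ x ∈ I.map f.toLinearMap,
      jordanMul a x ∈ I.map f.toLinearMap := by
    rintro _ ⟨a, ha, rfl⟩ _ ⟨x, hx, rfl⟩
    exact ⟨jordanMul a x, hmul a ha x hx, by simp [jordanMul]⟩
  rcases h.2 _ (Submodule.map_mono hI) hideal with hbot | htop
  · left
    refine I.eq_bot_iff.2 fun x hx => hf (hI hx) G.zero_mem ?_
    rw [map_zero]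
    exact (Submodule.eq_bot_iff _).1 hbot _ ⟨x, hx, rfl⟩
  · right
    exact SetLike.coe_injective <|
      (hf.image_eq_image_iff hI subset_rfl).1 (congrArg SetLike.coe htop)

theorem IsSpinFactor.map (hf : Set.InjOn f G) (h : IsSpinFactor G) :
    IsSpinFactor (G.map f.toLinearMap) := by
  obtain ⟨V, hdisj, hsup, hsq⟩ := h
  refine ⟨V.map f.toLinearMap, ?_, ?_, ?_⟩
  · rw [Submodule.disjoint_def] at hdisj ⊢
    rintro _ hx ⟨v, hv, rfl⟩
    obtain ⟨c, hc⟩ := Submodule.mem_span_singleton.1 hx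
    have hone : (1 : W) ∈ G := hsup ▸ Submodule.mem_sup_left (Submodule.mem_span_singleton_self 1)
    have hcv : c • (1 : W) = v := hf (G.smul_mem c hone) (hsup ▸ Submodule.mem_sup_right hv)
      (by rw [map_smul, map_one]; exact hc)
    rw [hdisj v (Submodule.mem_span_singleton.2 ⟨c, hcv⟩) hv, map_zero]
  · rw [← hsup, Submodule.map_sup, Submodule.map_span, Set.image_singleton]
    simp only [AlgHom.toLinearMap_apply, map_one]
  · rintro _ ⟨v, hv, rfl⟩
    obtain ⟨c, hc⟩ := hsq v hv
    exact ⟨c, by simp only [AlgHom.toLinearMap_apply, ← map_mul, hc, map_smul, map_one]⟩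

variable [StarRing W] [StarModule ℝ W]

theorem IsJordanSubspace.star_mem_adjoin (hG : IsJordanSubspace G) {x : W}
    (hx : x ∈ Algebra.adjoin ℝ (G : Set W)) : star x ∈ Algebra.adjoin ℝ (G : Set W) := by
  have hstar : star (G : Set W) = G := by
    rw [← Set.image_star, Set.image_congr hG.star_eq, Set.image_id']
  rwa [← Subalgebra.mem_star_iff, Subalgebra.star_adjoin_comm, hstar]

end InjectiveOnJordanSubspace

section JordanGraph

variable {R S : Type*} [Ring R] [Algebra ℝ R] [Ring S] [Algebra ℝ S] {A : Submodule ℝ R}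

/-- The graph of a linear map `g` defined on a subspace, as a subspace of the product algebra. -/
def jordanGraph (g : A →ₗ[ℝ] S) : Submodule ℝ (R × S) := LinearMap.range (A.subtype.prod g)

theorem mk_mem_jordanGraph (g : A →ₗ[ℝ] S) (a : A) : ((a : R), g a) ∈ jordanGraph g := ⟨a, rfl⟩

theorem injOn_fst_jordanGraph (g : A →ₗ[ℝ] S) :
    Set.InjOn (AlgHom.fst ℝ R S) (jordanGraph g) := by
  rintro _ ⟨a, rfl⟩ _ ⟨b, rfl⟩ hab
  rw [Subtype.ext hab]

theorem map_fst_jordanGraph (g : A →ₗ[ℝ] S) :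
    (jordanGraph g).map (AlgHom.fst ℝ R S).toLinearMap = A := by
  refine le_antisymm ?_ fun a ha => ⟨_, mk_mem_jordanGraph g ⟨a, ha⟩, rfl⟩
  rintro _ ⟨_, ⟨a, rfl⟩, rfl⟩
  exact a.2

theorem IsJordanHom.isJordanSubspace_jordanGraph [StarRing R] [StarRing S] {g : A →ₗ[ℝ] S}
    (hg : IsJordanHom g) (hA : IsJordanSubspace A) : IsJordanSubspace (jordanGraph g) where
  one_mem := ⟨⟨1, hA.one_mem⟩, Prod.ext rfl (hg.map_one _ rfl)⟩
  star_eq := by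
    rintro _ ⟨a, rfl⟩
    exact Prod.ext (hA.star_eq a a.2) (hg.star_map a)
  mul_add_mul_mem := by
    rintro _ ⟨a, rfl⟩ _ ⟨b, rfl⟩
    exact ⟨⟨_, hA.mul_add_mul_mem a a.2 b b.2⟩, Prod.ext rfl (hg.map_mul_add_mul a b _ rfl)⟩

end JordanGraph

section Clifford

variable {W : Type*} [Ring W] [StarRing W] [Algebra ℝ W] {I : Type*}

/-- A system of self-adjoint anticommuting square roots of `1`, that is, the images of orthonormal
generators of a positive definite Clifford algebra. -/
structure IsCliffordSystem (e : I → W) : Prop where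
  star_eq : ∀ i, star (e i) = e i
  mul_self : ∀ i, e i * e i = 1
  anticomm : ∀ i j, i ≠ j → e i * e j = -(e j * e i)

/-- A real linear functional on `W` that looks like the real part of a trace. -/
structure IsStarTrace (τ : W →ₗ[ℝ] ℝ) : Prop where
  map_mul_comm : ∀ x y, τ (x * y) = τ (y * x)
  map_star : ∀ x, τ (star x) = τ x

namespace IsCliffordSystem

variable {e : I → W} (he : IsCliffordSystem e)
include he

theorem prod_mul {j : I} {l : List I} (hj : j ∉ l) :
    (l.map e).prod * e j = (-1 : ℝ) ^ l.length • (e j * (l.map e).prod) := by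
  induction l with
  | nil => simp
  | cons a l ih =>
    rw [List.mem_cons, not_or] at hj
    rw [List.map_cons, List.prod_cons, mul_assoc, ih hj.2, mul_smul_comm, ← mul_assoc,
      he.anticomm a j (Ne.symm hj.1), List.length_cons, pow_succ]
    simp only [neg_mul, mul_assoc, smul_neg, mul_neg, mul_one, neg_smul]

theorem exists_nodup_prod (l : List I) :
    ∃ (l' : List I) (s : ℝ), l'.Nodup ∧ (l.map e).prod = s • (l'.map e).prod := by
  induction l with
  | nil => exact ⟨[], 1, List.nodup_nil, (one_smul ℝ _).symm⟩
  | cons a l ih =>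
    obtain ⟨l', s, hl', h⟩ := ih
    rw [List.map_cons, List.prod_cons, h]
    by_cases ha : a ∈ l'
    · obtain ⟨u, t, rfl⟩ := List.append_of_mem ha
      have hau : a ∉ u := fun hu => (List.nodup_append.1 hl').2.2 a hu a List.mem_cons_self rfl
      refine ⟨u ++ t, s * (-1) ^ u.length,
        hl'.sublist ((List.sublist_cons_self a t).append_left u), ?_⟩
      rw [List.map_append, List.prod_append, List.map_cons, List.prod_cons,
        ← mul_assoc (u.map e).prod, he.prod_mul hau, List.map_append, List.prod_append,
        mul_smul_comm, smul_mul_assoc, mul_smul_comm, ← mul_assoc, ← mul_assoc, he.mul_self,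
        one_mul, smul_smul]
    · exact ⟨a :: l', s, List.nodup_cons.2 ⟨ha, hl'⟩, by
        rw [mul_smul_comm, List.map_cons, List.prod_cons]⟩

theorem star_prod {l : List I} (hl : l.Nodup) :
    star (l.map e).prod = (-1 : ℝ) ^ l.length.choose 2 • (l.map e).prod := by
  induction l with
  | nil => simp
  | cons a l ih =>
    have ⟨hal, hl⟩ := List.nodup_cons.1 hl
    rw [List.map_cons, List.prod_cons, star_mul, ih hl, he.star_eq, smul_mul_assoc,
      he.prod_mul hal, smul_smul, ← pow_add, List.length_cons, Nat.choose_succ_succ' _ 1,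
      Nat.choose_one_right, add_comm]

variable {τ : W →ₗ[ℝ] ℝ} (hτ : IsStarTrace τ)
include hτ

theorem trace_prod_eq_zero_of_even {l : List I} (hl : l.Nodup) (hne : l ≠ [])
    (heven : Even l.length) : τ (l.map e).prod = 0 := by
  obtain ⟨a, t, rfl⟩ := List.exists_cons_of_ne_nil hne
  have hodd : Odd t.length := by
    rwa [List.length_cons, Nat.even_add_one, Nat.not_even_iff_odd] at heven
  have h := hτ.map_mul_comm (e a) (t.map e).prod
  rw [he.prod_mul (List.nodup_cons.1 hl).1, hodd.neg_one_pow, map_smul, smul_eq_mul] at h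
  rw [List.map_cons, List.prod_cons]
  linarith

theorem trace_prod_eq_zero_of_odd {l : List I} (hodd : Odd l.length) {j : I} (hj : j ∉ l) :
    τ (l.map e).prod = 0 := by
  have h := hτ.map_mul_comm (e j) (e j * (l.map e).prod)
  rw [mul_assoc, he.prod_mul hj, hodd.neg_one_pow, mul_smul_comm, ← mul_assoc, he.mul_self,
    one_mul, map_smul, smul_eq_mul] at h
  linarith

theorem trace_prod_eq_zero_of_length_mod_four {l : List I} (hl : l.Nodup)
    (hmod : l.length % 4 = 3) : τ (l.map e).prod = 0 := by
  have hchoose : Odd (l.length.choose 2) := by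
    obtain ⟨k, hk⟩ : ∃ k, l.length = 4 * k + 3 := ⟨l.length / 4, by omega⟩
    have hdouble : l.length * (l.length - 1) = (4 * k + 3) * (2 * k + 1) * 2 := by
      rw [hk, show 4 * k + 3 - 1 = (2 * k + 1) * 2 by omega, mul_assoc]
    rw [Nat.choose_two_right, hdouble, Nat.mul_div_cancel _ two_pos]
    exact Odd.mul ⟨2 * k + 1, by ring⟩ (odd_two_mul_add_one k)
  have h := hτ.map_star (l.map e).prod
  rw [he.star_prod hl, hchoose.neg_one_pow, map_smul, smul_eq_mul] at h
  linarith

variable [Fintype I] (hcard : Fintype.card I % 4 ≠ 1)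
include hcard

theorem trace_prod_eq_zero {l : List I} (hl : l.Nodup) (hne : l ≠ []) :
    τ (l.map e).prod = 0 := by
  rcases Nat.even_or_odd l.length with heven | hodd
  · exact he.trace_prod_eq_zero_of_even hτ hl hne heven
  by_cases hall : ∀ j, j ∈ l
  · classical
    have hlen : l.length = Fintype.card I := by
      rw [← List.toFinset_card_of_nodup hl, Finset.card_eq_iff_eq_univ,
        Finset.eq_univ_iff_forall]
      exact fun j => List.mem_toFinset.2 (hall j)
    refine he.trace_prod_eq_zero_of_length_mod_four hτ hl ?_
    rw [Nat.odd_iff] at hodd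
    omega
  · obtain ⟨j, hj⟩ := not_forall.1 hall
    exact he.trace_prod_eq_zero_of_odd hτ hodd hj

theorem trace_eq_zero (h1 : τ 1 = 0) {x : W} (hx : x ∈ Algebra.adjoin ℝ (Set.range e)) :
    τ x = 0 := by
  rw [← Subalgebra.mem_toSubmodule, Algebra.adjoin_eq_span] at hx
  suffices hle : Submodule.span ℝ (Submonoid.closure (Set.range e) : Set W) ≤ LinearMap.ker τ from
    hle hx
  rw [Submodule.span_le]
  intro y hy
  obtain ⟨l, hl, rfl⟩ := Submonoid.exists_list_of_mem_closure hy
  obtain ⟨l, rfl⟩ := (Set.range_list_map e).symm.subset hl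
  obtain ⟨l', s, hl', h⟩ := he.exists_nodup_prod l
  rw [SetLike.mem_coe, LinearMap.mem_ker, h, map_smul]
  rcases eq_or_ne l' [] with rfl | hne
  · rw [List.map_nil, List.prod_nil, h1, smul_zero]
  · rw [he.trace_prod_eq_zero hτ hcard hl' hne, smul_zero]

variable [StarModule ℝ W]

/-- The functional `ρ(1) τ - τ(1) (ρ ∘ f)` vanishes on the algebra generated by `e`, and at
`star x * x` it takes the value `ρ(1) τ (star x * x)`. -/
theorem eq_zero_of_mem_adjoin_of_map_eq_zero {R : Type*} [Ring R] [StarRing R] [Algebra ℝ R]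
    (hdef : ∀ x, τ (star x * x) = 0 → x = 0) {ρ : R →ₗ[ℝ] ℝ} (hρ : IsStarTrace ρ) (hρ1 : ρ 1 ≠ 0)
    (f : W →⋆ₐ[ℝ] R) {x : W} (hx : x ∈ Algebra.adjoin ℝ (Set.range e)) (hfx : f x = 0) :
    x = 0 := by
  let σ : W →ₗ[ℝ] ℝ := ρ 1 • τ - τ 1 • ρ ∘ₗ f.toAlgHom.toLinearMap
  have hσ : ∀ y, σ y = ρ 1 * τ y - τ 1 * ρ (f y) := fun y => rfl
  have hσtrace : IsStarTrace σ :=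
    ⟨fun y z => by rw [hσ, hσ, hτ.map_mul_comm, map_mul f, map_mul f, hρ.map_mul_comm],
      fun y => by rw [hσ, hσ, hτ.map_star, map_star, hρ.map_star]⟩
  have hstar : star (Set.range e) = Set.range e := by
    rw [← Set.image_star, ← Set.range_comp]
    exact congrArg Set.range (funext he.star_eq)
  have hxx : star x * x ∈ Algebra.adjoin ℝ (Set.range e) :=
    mul_mem (by rwa [← Subalgebra.mem_star_iff, Subalgebra.star_adjoin_comm, hstar]) hx
  have h := he.trace_eq_zero hσtrace hcard (by rw [hσ, map_one f, mul_comm, sub_self]) hxx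
  rw [hσ, map_mul f, hfx, mul_zero, map_zero, mul_zero, sub_zero] at h
  exact hdef x ((mul_eq_zero.1 h).resolve_left hρ1)

end IsCliffordSystem

end Clifford

section SpinFactor

theorem finrank_sup_span_one {W : Type*} [Ring W] [Algebra ℝ W] [Nontrivial W]
    {V : Submodule ℝ W} [FiniteDimensional ℝ V]
    (hdisj : Disjoint (Submodule.span ℝ {(1 : W)}) V) :
    Module.finrank ℝ ↥(Submodule.span ℝ {(1 : W)} ⊔ V) = Module.finrank ℝ V + 1 := by
  have h := Submodule.finrank_sup_add_finrank_inf_eq (Submodule.span ℝ {(1 : W)}) V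
  rw [hdisj.eq_bot, finrank_bot, finrank_span_singleton one_ne_zero] at h
  omega

variable {W : Type*} [Ring W] [StarRing W] [Algebra ℝ W] [StarModule ℝ W] [StarFormallyReal W]

theorem eq_zero_of_mul_self_eq_smul_one {v : W} (hv : star v = v) {c : ℝ}
    (h : v * v = c • (1 : W)) (hc : c ≤ 0) : v = 0 := by
  refine StarFormallyReal.eq_zero_of_add v (√(-c) • 1) ?_
  rw [hv, h, star_smul, star_one, star_trivial, smul_mul_smul_comm, mul_one,
    Real.mul_self_sqrt (neg_nonneg.2 hc), neg_smul, add_neg_cancel]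

variable [Nontrivial W] {V : Submodule ℝ W}

theorem exists_innerProductSpaceCore (hstar : ∀ v ∈ V, star v = v)
    (hsq : ∀ v ∈ V, ∃ c : ℝ, v * v = c • (1 : W)) :
    ∃ C : InnerProductSpace.Core ℝ V,
      ∀ v w : V, (v : W) * w + w * v = (2 * C.inner v w) • (1 : W) := by
  obtain ⟨τ, hτ⟩ := Module.Projective.exists_dual_eq_one ℝ (one_ne_zero (α := W))
  have hpolar : ∀ v w : V, (v : W) * w + w * v = τ (v * w + w * v) • (1 : W) := fun v w => by
    obtain ⟨a, ha⟩ := hsq _ (v + w).2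
    obtain ⟨b, hb⟩ := hsq v v.2
    obtain ⟨c, hc⟩ := hsq w w.2
    have hexpand : (v : W) * w + w * v = (a - b - c) • (1 : W) := by
      rw [sub_smul, sub_smul, ← ha, ← hb, ← hc, Submodule.coe_add]
      noncomm_ring
    rw [hexpand, map_smul, hτ, smul_eq_mul, mul_one]
  have hself : ∀ v : V, (v : W) * v = (τ (v * v + v * v) / 2) • (1 : W) := fun v => by
    rw [div_eq_inv_mul, mul_smul, ← hpolar, ← two_smul ℝ ((v : W) * v),
      inv_smul_smul₀ two_ne_zero]
  have hpos : ∀ v : V, τ (v * v + v * v) / 2 ≤ 0 → v = 0 := fun v h =>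
    Subtype.ext (eq_zero_of_mul_self_eq_smul_one (hstar v v.2) (hself v) h)
  refine ⟨{ inner := fun v w => τ (v * w + w * v) / 2
            conj_inner_symm := fun v w => by rw [add_comm]; rfl
            re_inner_nonneg := fun v => ?_
            add_left := fun v w x => ?_
            smul_left := fun v w r => ?_
            definite := fun v hv => hpos v hv.le }, fun v w => ?_⟩
  · by_contra! h
    obtain rfl := hpos v h.le
    simp at h
  · simp only [Submodule.coe_add, add_mul, mul_add, map_add]
    ring
  · simp only [Submodule.coe_smul, smul_mul_assoc, mul_smul_comm, map_add, map_smul, smul_eq_mul,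
      conj_trivial]
    ring
  · exact (hpolar v w).trans (congrArg (· • (1 : W)) (mul_div_cancel₀ _ two_ne_zero).symm)

theorem exists_isCliffordSystem [FiniteDimensional ℝ V] (hstar : ∀ v ∈ V, star v = v)
    (hsq : ∀ v ∈ V, ∃ c : ℝ, v * v = c • (1 : W)) :
    ∃ e : Fin (Module.finrank ℝ V) → W,
      IsCliffordSystem e ∧ Submodule.span ℝ (Set.range e) = V := by
  obtain ⟨C, hC⟩ := exists_innerProductSpaceCore hstar hsq
  let _ : NormedAddCommGroup V := C.toNormedAddCommGroup
  let _ : InnerProductSpace ℝ V := InnerProductSpace.ofCore C.toCore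
  let b := stdOrthonormalBasis ℝ V
  have hb : ∀ i j, (b i : W) * b j + b j * b i = (2 * if i = j then 1 else 0 : ℝ) • (1 : W) :=
    fun i j => (hC _ _).trans (by rw [← b.inner_eq_ite])
  refine ⟨fun i => b i, ⟨fun i => hstar _ (b i).2, fun i => ?_, fun i j hij => ?_⟩, ?_⟩
  · have h := hb i i
    rw [if_pos rfl, mul_one, ← two_smul ℝ ((b i : W) * b i)] at h
    exact smul_right_injective W two_ne_zero h
  · have h := hb i j
    rw [if_neg hij, mul_zero, zero_smul] at h
    exact eq_neg_of_add_eq_zero_left h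
  · have hspan := congrArg (Submodule.map V.subtype) b.toBasis.span_eq
    rwa [b.coe_toBasis, Submodule.map_span, Submodule.map_top, V.range_subtype,
      ← Set.range_comp] at hspan

/-- Otherwise, for a unit vector `e` of `V`, the element `(1 + e) / 2` is a nontrivial idempotent
that commutes with the whole Jordan algebra. -/
theorem finrank_ne_one_of_isSimpleJordan [FiniteDimensional ℝ V]
    (hG : IsJordanSubspace (Submodule.span ℝ {(1 : W)} ⊔ V))
    (hsimple : IsSimpleJordan (Submodule.span ℝ {(1 : W)} ⊔ V))
    (hdisj : Disjoint (Submodule.span ℝ {(1 : W)}) V)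
    (hsq : ∀ v ∈ V, ∃ c : ℝ, v * v = c • (1 : W)) : Module.finrank ℝ V ≠ 1 := by
  intro hrank
  obtain ⟨e, he, hspan⟩ := exists_isCliffordSystem
    (fun v hv => hG.star_eq v (Submodule.mem_sup_right hv)) hsq
  let i : Fin (Module.finrank ℝ V) := ⟨0, hrank ▸ one_pos⟩
  have hi : e i ∈ V := hspan ▸ Submodule.subset_span ⟨i, rfl⟩
  have hi0 : e i ≠ 0 := fun h => one_ne_zero <| (he.mul_self i).symm.trans (by rw [h, mul_zero])
  have hcomm : ∀ a ∈ Submodule.span ℝ {(1 : W)} ⊔ V, Commute (e i) a := by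
    have hle : Submodule.span ℝ {(1 : W)} ⊔ Submodule.span ℝ (Set.range e) ≤
        Subalgebra.toSubmodule (Subalgebra.centralizer ℝ {e i}) := by
      refine sup_le (Submodule.span_le.2 ?_) (Submodule.span_le.2 ?_)
      · exact Set.singleton_subset_iff.2 (one_mem (Subalgebra.centralizer ℝ {e i}))
      · rintro _ ⟨j, rfl⟩
        obtain rfl : j = i := Fin.ext (by have := j.2; change (j : ℕ) = 0; omega)
        exact Subalgebra.mem_centralizer_iff ℝ |>.2 (by rintro _ rfl; rfl)
    rw [hspan] at hle
    exact fun a ha => Subalgebra.mem_centralizer_iff ℝ |>.1 (hle ha) _ rfl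
  have hidem : IsIdempotentElem ((1 / 2 : ℝ) • (1 + e i)) := by
    rw [IsIdempotentElem, smul_mul_smul_comm, add_mul, mul_add, mul_add, he.mul_self, one_mul,
      mul_one, one_mul]
    module
  have hscalar : ∀ c : ℝ, (1 / 2 : ℝ) • (1 + e i) ≠ c • 1 := fun c hc => by
    have hei : e i = (2 * c - 1) • (1 : W) := by
      rw [sub_smul, mul_smul, ← hc]
      module
    exact hi0 (Submodule.disjoint_def.1 hdisj _ (Submodule.mem_span_singleton.2 ⟨_, hei.symm⟩) hi)
  rcases hsimple.eq_zero_or_eq_one_of_mul_eq hG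
    (Submodule.smul_mem _ _ (add_mem hG.one_mem (Submodule.mem_sup_right hi))) hidem
    fun a ha => by
      rw [mul_assoc, ((Commute.one_right a).add_right (hcomm a ha).symm |>.smul_right _).eq,
        ← mul_assoc, hidem.eq] with h | h
  · exact hscalar 0 (by rw [h, zero_smul])
  · exact hscalar 1 (by rw [h, one_smul])

theorem IsSpinFactor.exists_isCliffordSystem [FiniteDimensional ℝ W] {G : Submodule ℝ W}
    (hspin : IsSpinFactor G) (hG : IsJordanSubspace G) (hsimple : IsSimpleJordan G) :
    ∃ (d : ℕ) (e : Fin d → W), IsCliffordSystem e ∧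
      Algebra.adjoin ℝ (G : Set W) ≤ Algebra.adjoin ℝ (Set.range e) ∧
      d ≠ 1 ∧ Module.finrank ℝ G = d + 1 := by
  obtain ⟨V, hdisj, rfl, hsq⟩ := hspin
  obtain ⟨e, he, hspan⟩ := _root_.exists_isCliffordSystem
    (fun v hv => hG.star_eq v (Submodule.mem_sup_right hv)) hsq
  refine ⟨_, e, he, Algebra.adjoin_le ?_, finrank_ne_one_of_isSimpleJordan hG hsimple hdisj hsq,
    finrank_sup_span_one hdisj⟩
  have hle : Submodule.span ℝ {(1 : W)} ⊔ Submodule.span ℝ (Set.range e) ≤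
      Subalgebra.toSubmodule (Algebra.adjoin ℝ (Set.range e)) :=
    sup_le
      (Submodule.span_le.2 <| Set.singleton_subset_iff.2 (one_mem (Algebra.adjoin ℝ (Set.range e))))
      (Algebra.span_le_adjoin ℝ _)
  rwa [hspan] at hle

theorem IsJordanSubspace.eq_zero_of_mem_adjoin_of_map_eq_zero [FiniteDimensional ℝ W]
    {R : Type*} [Ring R] [StarRing R] [Algebra ℝ R] {f : W →⋆ₐ[ℝ] R}
    {τ : W →ₗ[ℝ] ℝ} (hτ : IsStarTrace τ) (hdef : ∀ x, τ (star x * x) = 0 → x = 0)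
    {ρ : R →ₗ[ℝ] ℝ} (hρ : IsStarTrace ρ) (hρ1 : ρ 1 ≠ 0) {G : Submodule ℝ W}
    (hG : IsJordanSubspace G) (hsimple : IsSimpleJordan G)
    (hspin : ¬ (IsSpinFactor G ∧ ∃ k : ℕ, 1 ≤ k ∧ Module.finrank ℝ G = 4 * k + 2))
    (hf : Set.InjOn f G) {x : W} (hx : x ∈ Algebra.adjoin ℝ (G : Set W)) (hfx : f x = 0) :
    x = 0 := by
  by_cases h : IsSpinFactor G
  · obtain ⟨d, e, he, hle, hd, hrank⟩ := h.exists_isCliffordSystem hG hsimple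
    have hcard : Fintype.card (Fin d) % 4 ≠ 1 := fun h4 => by
      rw [Fintype.card_fin] at h4
      exact hspin ⟨h, d / 4, by omega, by omega⟩
    exact he.eq_zero_of_mem_adjoin_of_map_eq_zero hτ hcard hdef hρ hρ1 f (hle hx) hfx
  · have hmem : star x * x ∈ G := hG.mem_of_mem_adjoin hsimple h
      (mul_mem (hG.star_mem_adjoin hx) hx) (by rw [star_mul, star_star])
    exact eq_zero_of_star_mul_self_eq_zero
      (hf hmem G.zero_mem (by rw [map_mul, hfx, mul_zero, map_zero]))

end SpinFactor

section Complexification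

theorem exists_add_I_smul_of_mem_adjoin {W : Type*} [Ring W] [Algebra ℝ W] [Algebra ℂ W]
    [IsScalarTower ℝ ℂ W] {T : Subalgebra ℝ W} {z : W} (hz : z ∈ Algebra.adjoin ℂ (T : Set W)) :
    ∃ x ∈ T, ∃ y ∈ T, z = x + Complex.I • y := by
  induction hz using Algebra.adjoin_induction with
  | mem x hx => exact ⟨x, hx, 0, zero_mem T, by rw [smul_zero, add_zero]⟩
  | algebraMap c =>
    refine ⟨algebraMap ℝ W c.re, T.algebraMap_mem _, algebraMap ℝ W c.im, T.algebraMap_mem _, ?_⟩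
    rw [IsScalarTower.algebraMap_apply ℝ ℂ W, IsScalarTower.algebraMap_apply ℝ ℂ W,
      Algebra.smul_def, ← map_mul, ← map_add, Complex.coe_algebraMap,
      mul_comm, Complex.re_add_im]
  | add u v _ _ hu hv =>
    obtain ⟨x, hx, y, hy, rfl⟩ := hu
    obtain ⟨x', hx', y', hy', rfl⟩ := hv
    exact ⟨x + x', add_mem hx hx', y + y', add_mem hy hy', by rw [smul_add]; abel⟩
  | mul u v _ _ hu hv =>
    obtain ⟨x, hx, y, hy, rfl⟩ := hu
    obtain ⟨x', hx', y', hy', rfl⟩ := hv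
    refine ⟨x * x' - y * y', sub_mem (mul_mem hx hx') (mul_mem hy hy'), x * y' + y * x',
      add_mem (mul_mem hx hy') (mul_mem hy hx'), ?_⟩
    rw [add_mul, mul_add, mul_add, smul_mul_smul_comm, Complex.I_mul_I, smul_mul_assoc,
      mul_smul_comm, neg_one_smul, smul_add]
    abel

/-- The elements `y` with `y ∈ R` and `i y ∈ R` form a two-sided ideal of `R + i R`. -/
theorem eq_top_or_disjoint_I_smul {M : Type*} [Ring M] [IsSimpleRing M] [Algebra ℝ M]
    [Algebra ℂ M] [IsScalarTower ℝ ℂ M] {R : Subalgebra ℝ M}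
    (hgen : Algebra.adjoin ℂ (R : Set M) = ⊤) :
    R = ⊤ ∨ ∀ y ∈ R, Complex.I • y ∈ R → y = 0 := by
  have hspan : ∀ z : M, ∃ x ∈ R, ∃ y ∈ R, z = x + Complex.I • y := fun z =>
    exists_add_I_smul_of_mem_adjoin (hgen ▸ Algebra.mem_top)
  have hII : ∀ z : M, Complex.I • Complex.I • z = -z := fun z => by
    rw [smul_smul, Complex.I_mul_I, neg_one_smul]
  let J : TwoSidedIdeal M := TwoSidedIdeal.mk' {x | x ∈ R ∧ Complex.I • x ∈ R}
    ⟨zero_mem R, by rw [smul_zero]; exact zero_mem R⟩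
    (fun hx hy => ⟨add_mem hx.1 hy.1, by rw [smul_add]; exact add_mem hx.2 hy.2⟩)
    (fun hx => ⟨neg_mem hx.1, by rw [smul_neg]; exact neg_mem hx.2⟩)
    (fun {z x} hx => by
      obtain ⟨u, hu, v, hv, rfl⟩ := hspan z
      constructor
      · rw [add_mul, smul_mul_assoc, ← mul_smul_comm]
        exact add_mem (mul_mem hu hx.1) (mul_mem hv hx.2)
      · rw [add_mul, smul_add, smul_mul_assoc, hII, ← mul_smul_comm]
        exact add_mem (mul_mem hu hx.2) (neg_mem (mul_mem hv hx.1)))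
    (fun {x z} hx => by
      obtain ⟨u, hu, v, hv, rfl⟩ := hspan z
      constructor
      · rw [mul_add, mul_smul_comm, ← smul_mul_assoc]
        exact add_mem (mul_mem hx.1 hu) (mul_mem hx.2 hv)
      · rw [mul_add, smul_add, mul_smul_comm, hII, ← smul_mul_assoc]
        exact add_mem (mul_mem hx.2 hu) (neg_mem (mul_mem hx.1 hv)))
  have hJ : ∀ x, x ∈ J ↔ x ∈ R ∧ Complex.I • x ∈ R := fun x => TwoSidedIdeal.mem_mk' ..
  rcases eq_bot_or_eq_top J with h | h
  · refine .inr fun y hy hIy => ?_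
    rw [← TwoSidedIdeal.mem_bot, ← h, hJ]
    exact ⟨hy, hIy⟩
  · exact .inl (eq_top_iff.2 fun w _ => ((hJ w).1 (by rw [h]; exact TwoSidedIdeal.mem_top _)).1)

end Complexification

section ExtensionFromGraph

variable {M S : Type*} [Ring M] [StarRing M] [Algebra ℝ M] [StarModule ℝ M]
  [Ring S] [StarRing S] [Algebra ℝ S] [StarModule ℝ S] {T : StarSubalgebra ℝ (M × S)}

theorem exists_starAlgHom_of_bijOn_fst (hT : Set.BijOn Prod.fst (T : Set (M × S)) Set.univ) :
    ∃ Ψ : M →⋆ₐ[ℝ] S, ∀ x ∈ T, Ψ x.1 = x.2 := by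
  let π : T →⋆ₐ[ℝ] M := (StarAlgHom.fst ℝ M S).comp T.subtype
  have hπ : Function.Bijective π :=
    ⟨fun x y hxy => Subtype.ext (hT.injOn x.2 y.2 hxy), fun z => by
      obtain ⟨x, hx, rfl⟩ := hT.surjOn (Set.mem_univ z)
      exact ⟨⟨x, hx⟩, rfl⟩⟩
  let e : T ≃⋆ₐ[ℝ] M := StarAlgEquiv.ofBijective π hπ
  refine ⟨(StarAlgHom.snd ℝ M S).comp (T.subtype.comp (e.symm : M →⋆ₐ[ℝ] T)), fun x hx => ?_⟩
  have hsymm : e.symm x.1 = ⟨x, hx⟩ := e.symm_apply_apply ⟨x, hx⟩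
  change ((e.symm x.1 : T) : M × S).2 = x.2
  rw [hsymm]

variable [IsSimpleRing M] [Algebra ℂ M] [IsScalarTower ℝ ℂ M] [StarModule ℂ M]
  [Algebra ℂ S] [IsScalarTower ℝ ℂ S] [StarModule ℂ S]

/-- Either `T` already projects onto `M`, or `T + i T` is again the graph of a homomorphism. -/
theorem exists_starAlgHom_of_adjoin_eq_top (hT : ∀ x ∈ T, x.1 = 0 → x = 0)
    (hgen : Algebra.adjoin ℂ (Prod.fst '' (T : Set (M × S))) = ⊤) :
    ∃ Ψ : M →⋆ₐ[ℝ] S, ∀ x ∈ T, Ψ x.1 = x.2 := by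
  let R : Subalgebra ℝ M := T.toSubalgebra.map (AlgHom.fst ℝ M S)
  have hinjOn : ∀ T' : StarSubalgebra ℝ (M × S), (∀ x ∈ T', x.1 = 0 → x = 0) →
      Set.InjOn Prod.fst (T' : Set (M × S)) := fun T' h x hx y hy hxy =>
    sub_eq_zero.1 (h _ (sub_mem hx hy) (sub_eq_zero.2 hxy))
  rcases eq_top_or_disjoint_I_smul (R := R) hgen with htop | hdisj
  · refine exists_starAlgHom_of_bijOn_fst ⟨Set.mapsTo_univ _ _, hinjOn T hT, fun z _ => ?_⟩
    have hz : z ∈ R := htop ▸ Algebra.mem_top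
    exact hz
  · let T' : StarSubalgebra ℝ (M × S) :=
      { (Algebra.adjoin ℂ (T : Set (M × S))).restrictScalars ℝ with
        star_mem' := fun {x} hx => by
          change star x ∈ Algebra.adjoin ℂ (T : Set (M × S))
          rwa [← Subalgebra.mem_star_iff, Subalgebra.star_adjoin_comm, StarMemClass.star_coe_eq] }
    have hT' : ∀ x ∈ T', x.1 = 0 → x = 0 := fun z hz hz0 => by
      obtain ⟨x, hx, y, hy, rfl⟩ := exists_add_I_smul_of_mem_adjoin (T := T.toSubalgebra) hz
      have hy0 : y = 0 := hT y hy <| hdisj _ ⟨y, hy, rfl⟩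
        ⟨-x, T.toSubalgebra.neg_mem hx, neg_eq_of_add_eq_zero_right hz0⟩
      subst hy0
      rw [smul_zero, add_zero] at hz0 ⊢
      exact hT x hx hz0
    have hsurj : Set.SurjOn Prod.fst (T' : Set (M × S)) Set.univ := fun z _ => by
      have hz : z ∈ (Algebra.adjoin ℂ (T : Set (M × S))).map (AlgHom.fst ℂ M S) := by
        rw [AlgHom.map_adjoin]
        exact hgen.ge Algebra.mem_top
      exact hz
    obtain ⟨Ψ, hΨ⟩ := exists_starAlgHom_of_bijOn_fst
      ⟨Set.mapsTo_univ _ _, hinjOn T' hT', hsurj⟩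
    exact ⟨Ψ, fun x hx => hΨ x (Algebra.subset_adjoin (R := ℂ) hx)⟩

end ExtensionFromGraph

section Trace

open Matrix
open scoped ComplexOrder

variable {W R : Type*} [Ring W] [StarRing W] [Algebra ℝ W] [Ring R] [StarRing R] [Algebra ℝ R]

theorem IsStarTrace.coprod {τ : W →ₗ[ℝ] ℝ} (hτ : IsStarTrace τ) {ρ : R →ₗ[ℝ] ℝ}
    (hρ : IsStarTrace ρ) : IsStarTrace (τ.coprod ρ) where
  map_mul_comm x y := congrArg₂ (· + ·) (hτ.map_mul_comm x.1 y.1) (hρ.map_mul_comm x.2 y.2)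
  map_star x := congrArg₂ (· + ·) (hτ.map_star x.1) (hρ.map_star x.2)

variable (μ : Type*) [Fintype μ]

/-- The real part of the trace of a complex matrix, as a real linear functional. -/
noncomputable def reTrace : Matrix μ μ ℂ →ₗ[ℝ] ℝ := Complex.reLm ∘ₗ traceLinearMap μ ℝ ℂ

variable {μ}

theorem reTrace_apply (x : Matrix μ μ ℂ) : reTrace μ x = x.trace.re := rfl

theorem reTrace_star_mul_self_nonneg (x : Matrix μ μ ℂ) : 0 ≤ reTrace μ (star x * x) :=
  (Complex.le_def.1 (posSemidef_conjTranspose_mul_self x).trace_nonneg).1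

theorem eq_zero_of_reTrace_star_mul_self {x : Matrix μ μ ℂ} (h : reTrace μ (star x * x) = 0) :
    x = 0 := by
  have him := (Complex.le_def.1 (posSemidef_conjTranspose_mul_self x).trace_nonneg).2
  exact trace_conjTranspose_mul_self_eq_zero_iff.1 (Complex.ext h him.symm)

theorem eq_zero_of_reTrace_coprod_star_mul_self {ν : Type*} [Fintype ν]
    {x : Matrix μ μ ℂ × Matrix ν ν ℂ} (h : (reTrace μ).coprod (reTrace ν) (star x * x) = 0) :
    x = 0 := by
  obtain ⟨h1, h2⟩ := (add_eq_zero_iff_of_nonneg (reTrace_star_mul_self_nonneg x.1)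
    (reTrace_star_mul_self_nonneg x.2)).1 h
  exact Prod.ext (eq_zero_of_reTrace_star_mul_self h1) (eq_zero_of_reTrace_star_mul_self h2)

variable [DecidableEq μ]

theorem isStarTrace_reTrace : IsStarTrace (reTrace μ) where
  map_mul_comm x y := by rw [reTrace_apply, trace_mul_comm, reTrace_apply]
  map_star x := by
    rw [reTrace_apply, star_eq_conjTranspose, trace_conjTranspose, Complex.star_def,
      Complex.conj_re, reTrace_apply]

theorem reTrace_one_ne_zero [Nonempty μ] : reTrace μ 1 ≠ 0 := by
  rw [reTrace_apply, trace_one, Complex.natCast_re]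
  exact_mod_cast Fintype.card_ne_zero

end Trace

section Existence

variable {μ ν : Type*} [Fintype μ] [DecidableEq μ] [Fintype ν] [DecidableEq ν]
  {A : Submodule ℝ (Matrix μ μ ℂ)}

theorem IsSimpleJordan.nonempty (hsimple : IsSimpleJordan A) : Nonempty μ := by
  by_contra h
  rw [not_nonempty_iff] at h
  exact hsimple.1 (Subsingleton.elim _ _)

theorem IsJordanHom.exists_starAlgHom {g : A →ₗ[ℝ] Matrix ν ν ℂ} (hg : IsJordanHom g)
    (hA : IsJordanSubspace A) (hsimple : IsSimpleJordan A)
    (hspin : ¬ (IsSpinFactor A ∧ ∃ k : ℕ, 1 ≤ k ∧ Module.finrank ℝ A = 4 * k + 2))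
    (hgen : Algebra.adjoin ℂ (A : Set (Matrix μ μ ℂ)) = ⊤) :
    ∃ Ψ : Matrix μ μ ℂ →⋆ₐ[ℝ] Matrix ν ν ℂ, ∀ a : A, Ψ a = g a := by
  have := hsimple.nonempty
  have hG := hg.isJordanSubspace_jordanGraph hA
  have hinj := injOn_fst_jordanGraph g
  have hmap := map_fst_jordanGraph g
  have hrank : Module.finrank ℝ (jordanGraph g) = Module.finrank ℝ A :=
    LinearMap.finrank_range_of_inj fun a b hab => Subtype.ext (congrArg Prod.fst hab)
  have hspin' : ¬ (IsSpinFactor (jordanGraph g) ∧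
      ∃ k : ℕ, 1 ≤ k ∧ Module.finrank ℝ (jordanGraph g) = 4 * k + 2) := by
    rw [hrank]
    exact fun h => hspin ⟨hmap ▸ h.1.map hinj, h.2⟩
  let T : StarSubalgebra ℝ (Matrix μ μ ℂ × Matrix ν ν ℂ) :=
    { Algebra.adjoin ℝ (jordanGraph g : Set (Matrix μ μ ℂ × Matrix ν ν ℂ)) with
      star_mem' := hG.star_mem_adjoin }
  have hsub : ∀ a : A, ((a : Matrix μ μ ℂ), g a) ∈ T := fun a =>
    Algebra.subset_adjoin (R := ℝ) (mk_mem_jordanGraph g a)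
  have hT : ∀ x ∈ T, x.1 = 0 → x = 0 := fun x hx hx1 =>
    hG.eq_zero_of_mem_adjoin_of_map_eq_zero (f := StarAlgHom.fst ℝ _ _)
      (isStarTrace_reTrace.coprod isStarTrace_reTrace)
      (fun _ => eq_zero_of_reTrace_coprod_star_mul_self) isStarTrace_reTrace reTrace_one_ne_zero
      (.of_map (f := AlgHom.fst ℝ _ _) hinj (hmap.symm ▸ hsimple)) hspin' hinj hx hx1
  obtain ⟨Ψ, hΨ⟩ := exists_starAlgHom_of_adjoin_eq_top hT <|
    top_le_iff.1 <| hgen.ge.trans (Algebra.adjoin_mono fun a ha => ⟨_, hsub ⟨a, ha⟩, rfl⟩)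
  exact ⟨Ψ, fun a => hΨ _ (hsub a)⟩

theorem exists_starAlgHom_extension [Nonempty μ] {𝒜 : StarSubalgebra ℝ (Matrix μ μ ℂ)}
    (hgen : Algebra.adjoin ℂ (𝒜 : Set (Matrix μ μ ℂ)) = ⊤) (Φ : 𝒜 →⋆ₐ[ℝ] Matrix ν ν ℂ) :
    ∃ Ψ : Matrix μ μ ℂ →⋆ₐ[ℝ] Matrix ν ν ℂ, ∀ α : 𝒜, Ψ α = Φ α := by
  obtain ⟨Ψ, hΨ⟩ := exists_starAlgHom_of_adjoin_eq_top (T := (𝒜.subtype.prod Φ).range)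
    (by
      rintro _ ⟨α, rfl⟩ hα
      obtain rfl : α = 0 := Subtype.ext hα
      exact map_zero (𝒜.subtype.prod Φ)) <|
    top_le_iff.1 <| hgen.ge.trans (Algebra.adjoin_mono fun a ha => ⟨_, ⟨⟨a, ha⟩, rfl⟩, rfl⟩)
  exact ⟨Ψ, fun α => hΨ _ ⟨α, rfl⟩⟩

end Existence

section LinearPart

variable {R S : Type*} [Ring R] [StarRing R] [Algebra ℝ R] [Algebra ℂ R]
  [Ring S] [StarRing S] [Algebra ℝ S]

theorem map_I_smul_one_mul_self (Ψ : R →⋆ₐ[ℝ] S) :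
    Ψ (Complex.I • 1) * Ψ (Complex.I • 1) = -1 := by
  rw [← map_mul, smul_mul_smul_comm, Complex.I_mul_I, mul_one, neg_one_smul, map_neg, map_one]

variable [Algebra ℂ S]

/-- The projection `(1 - i Ψ(i)) / 2`, which cuts out the complex linear summand of a real
`*`-homomorphism `Ψ`; the complementary summand is conjugate linear. -/
noncomputable def linearPart (Ψ : R →⋆ₐ[ℝ] S) : S :=
  (1 / 2 : ℂ) • (1 - Complex.I • Ψ (Complex.I • 1))

theorem commute_linearPart_map (Ψ : R →⋆ₐ[ℝ] S) (x : R) : Commute (linearPart Ψ) (Ψ x) := by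
  have h : Commute (Ψ (Complex.I • 1)) (Ψ x) :=
    ((Commute.one_left x).smul_left Complex.I).map Ψ
  exact ((Commute.one_left _).sub_left (h.smul_left _)).smul_left _

theorem isStarProjection_linearPart [StarModule ℂ R] [StarModule ℂ S] (Ψ : R →⋆ₐ[ℝ] S) :
    IsStarProjection (linearPart Ψ) where
  isIdempotentElem := by
    have h := map_I_smul_one_mul_self Ψ
    rw [IsIdempotentElem, linearPart, smul_mul_smul_comm, sub_mul, mul_sub, mul_sub,
      smul_mul_smul_comm, h, Complex.I_mul_I, one_mul, one_mul, mul_one]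
    module
  isSelfAdjoint := by
    rw [IsSelfAdjoint, linearPart, star_smul, star_sub, star_smul, ← map_star, star_smul, star_one]
    simp

theorem map_smul_one_eq_linearPart [IsScalarTower ℝ ℂ R] [IsScalarTower ℝ ℂ S]
    (Ψ : R →⋆ₐ[ℝ] S) (c : ℂ) :
    Ψ (c • 1) = c • linearPart Ψ + starRingEnd ℂ c • (1 - linearPart Ψ) := by
  have hre (r : ℝ) : Ψ ((r : ℂ) • 1) = (r : ℂ) • 1 := by
    rw [← Algebra.algebraMap_eq_smul_one, ← Algebra.algebraMap_eq_smul_one,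
      ← Complex.coe_algebraMap, ← IsScalarTower.algebraMap_apply,
      ← IsScalarTower.algebraMap_apply, AlgHomClass.commutes]
  have hc : c • (1 : R) = (c.re : ℂ) • 1 + ((c.im : ℂ) • 1) * (Complex.I • 1) := by
    rw [smul_mul_smul_comm, mul_one, ← add_smul, Complex.re_add_im]
  have hconj : starRingEnd ℂ c = c.re - c.im * Complex.I := by
    apply Complex.ext <;> simp
  rw [hc, map_add, map_mul, hre, hre, smul_one_mul, linearPart, hconj]
  nth_rewrite 3 [← Complex.re_add_im c]
  match_scalars
  · ring
  · linear_combination (c.im : ℂ) * Complex.I_sq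

end LinearPart

section Isometry

open Matrix

variable {𝕜 ν : Type*} [Fintype ν]

theorem mul_eq_self_of_mul_eq_one [Semiring 𝕜] {κ : Type*} [Fintype κ] [DecidableEq κ]
    {P : Matrix ν ν 𝕜} {v : Matrix ν κ 𝕜} {u : Matrix κ ν 𝕜} (huv : u * v = 1)
    (hvu : v * u = P) : P * v = v := by
  rw [← hvu, Matrix.mul_assoc, huv, Matrix.mul_one]

theorem exists_isometry_of_isStarProjection [RCLike 𝕜] {P : Matrix ν ν 𝕜}
    (hP : IsStarProjection P) :
    ∃ (p : ℕ) (v : Matrix ν (Fin p) 𝕜), vᴴ * v = 1 ∧ v * vᴴ = P := by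
  classical
  have hH : P.IsHermitian := hP.isSelfAdjoint
  have hev (i : ν) (hi : hH.eigenvalues i ≠ 1) : hH.eigenvalues i = 0 :=
    (hP.isIdempotentElem.spectrum_subset ℝ (hH.eigenvalues_mem_spectrum_real i)).resolve_right hi
  let e := Fintype.equivFin {i // hH.eigenvalues i = 1}
  let U : Matrix ν ν 𝕜 := hH.eigenvectorUnitary
  refine ⟨_, U.submatrix id fun k => (e.symm k : ν), ?_, ?_⟩
  · rw [conjTranspose_submatrix, ← submatrix_mul _ _ _ _ _ Function.bijective_id,
      ← star_eq_conjTranspose, Unitary.coe_star_mul_self]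
    exact submatrix_one _ (Subtype.val_injective.comp e.symm.injective)
  · have hspec : P = U * diagonal (RCLike.ofReal ∘ hH.eigenvalues) * star U :=
      hH.spectral_theorem
    ext i j
    refine .trans ?_ (congrFun₂ hspec i j).symm
    rw [mul_apply, mul_apply]
    simp only [mul_diagonal, submatrix_apply, conjTranspose_apply, id, star_apply]
    rw [Equiv.sum_comp e.symm fun k => U i k * star (U j k),
      ← Finset.sum_subtype (Finset.univ.filter fun k => hH.eigenvalues k = 1) (by simp)
        (fun k => U i k * star (U j k)), Finset.sum_filter]
    refine Finset.sum_congr rfl fun k _ => ?_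
    split_ifs with h
    · simp [h]
    · simp [hev k h]

/-- The diagonal matrix with `p` entries `c` and `q` entries `c̄`. -/
def conjDiagonal (p q : ℕ) (c : ℂ) : Matrix (Fin p ⊕ Fin q) (Fin p ⊕ Fin q) ℂ :=
  diagonal (Sum.elim (fun _ => c) fun _ => starRingEnd ℂ c)

theorem exists_isometry_conjDiagonal [DecidableEq ν] {Z P : Matrix ν ν ℂ} (hZ : IsStarProjection Z)
    (hP : IsStarProjection P) (hZP : Commute Z P) :
    ∃ (p q : ℕ) (w : Matrix ν (Fin p ⊕ Fin q) ℂ), wᴴ * w = 1 ∧ w * wᴴ = P ∧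
      ∀ c : ℂ, (c • Z + starRingEnd ℂ c • (1 - Z)) * w = w * conjDiagonal p q c := by
  obtain ⟨p, v, hv, hvP⟩ := exists_isometry_of_isStarProjection (hZ.mul hP hZP)
  obtain ⟨q, v', hv', hvP'⟩ := exists_isometry_of_isStarProjection
    (hZ.one_sub.mul hP ((Commute.one_left P).sub_left hZP))
  have hZv : Z * v = v := by
    rw [← mul_eq_self_of_mul_eq_one hv hvP, ← Matrix.mul_assoc, ← Matrix.mul_assoc,
      hZ.isIdempotentElem.eq]
  have hZv' : Z * v' = 0 := by
    rw [← mul_eq_self_of_mul_eq_one hv' hvP', ← Matrix.mul_assoc, ← Matrix.mul_assoc,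
      hZ.isIdempotentElem.mul_one_sub_self, Matrix.zero_mul, Matrix.zero_mul]
  have hvv' : vᴴ * v' = 0 := by
    rw [← hZv, conjTranspose_mul, ← star_eq_conjTranspose Z, hZ.isSelfAdjoint.star_eq,
      Matrix.mul_assoc, hZv', Matrix.mul_zero]
  refine ⟨p, q, fromCols v v', ?_, ?_, fun c => ?_⟩
  · rw [conjTranspose_fromCols_eq_fromRows_conjTranspose, fromRows_mul_fromCols, hv, hv', hvv',
      ← conjTranspose_conjTranspose (v'ᴴ * v), conjTranspose_mul, conjTranspose_conjTranspose,
      hvv', conjTranspose_zero, fromBlocks_one]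
  · rw [conjTranspose_fromCols_eq_fromRows_conjTranspose, fromCols_mul_fromRows, hvP, hvP',
      ← add_mul, add_sub_cancel, one_mul]
  · rw [mul_fromCols, Matrix.add_mul, Matrix.add_mul, smul_mul, smul_mul, smul_mul, smul_mul,
      Matrix.sub_mul, Matrix.sub_mul, hZv, hZv', Matrix.one_mul, Matrix.one_mul]
    ext i (s | s) <;> simp [conjDiagonal, mul_diagonal, mul_comm]

end Isometry

section BlockColumns

open Matrix

variable {𝕜 μ ν κ : Type*}

/-- The matrix with block columns `F j`, for `j : μ`. -/
def blockColumns (F : μ → Matrix ν κ 𝕜) : Matrix ν (μ × κ) 𝕜 := of fun a x => F x.1 a x.2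

theorem mul_blockColumns [NonUnitalNonAssocSemiring 𝕜] [Fintype ν] {ν' : Type*}
    (x : Matrix ν' ν 𝕜) (F : μ → Matrix ν κ 𝕜) :
    x * blockColumns F = blockColumns fun j => x * F j :=
  rfl

theorem conjTranspose_blockColumns_mul_self_eq_one [Semiring 𝕜] [StarRing 𝕜] [Fintype ν]
    [DecidableEq μ] [DecidableEq κ] {F : μ → Matrix ν κ 𝕜} (hF : ∀ j, (F j)ᴴ * F j = 1)
    (hF' : Pairwise fun i j => (F i)ᴴ * F j = 0) :
    (blockColumns F)ᴴ * blockColumns F = 1 := by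
  ext ⟨i, s⟩ ⟨j, t⟩
  change ((F i)ᴴ * F j) s t = _
  by_cases hij : i = j
  · subst hij
    rw [hF]
    simp [one_apply]
  · rw [hF' hij]
    simp [one_apply, hij]

theorem blockColumns_mul_conjTranspose [NonUnitalSemiring 𝕜] [StarRing 𝕜] [Fintype μ] [Fintype κ]
    (F : μ → Matrix ν κ 𝕜) : blockColumns F * (blockColumns F)ᴴ = ∑ j, F j * (F j)ᴴ := by
  ext a b
  rw [mul_apply, Fintype.sum_prod_type, Matrix.sum_apply]
  rfl

theorem blockColumns_mul_copies {n p q : ℕ} (F : Fin n → Matrix ν (Fin p ⊕ Fin q) ℂ)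
    (α : MatAlg n) :
    blockColumns F * copies p q α =
      blockColumns fun j => ∑ l, F l * conjDiagonal p q (α l j) := by
  ext a ⟨j, s⟩
  simp only [blockColumns, of_apply, mul_apply, Fintype.sum_prod_type, Matrix.sum_apply]
  refine Finset.sum_congr rfl fun l _ => Finset.sum_congr rfl fun t _ => ?_
  rcases s with s | s <;> rcases t with t | t <;>
    simp [copies, conjDiagonal, blockDiagonal_apply, diagonal_apply]

end BlockColumns

section Form

open Matrix

variable {n : ℕ} {ν : Type*} [Fintype ν] [DecidableEq ν]

theorem exists_map_mul_eq_mul_copies [Nonempty (Fin n)] (Ψ : MatAlg n →⋆ₐ[ℝ] Matrix ν ν ℂ) :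
    ∃ (p q : ℕ) (V : Matrix ν (Fin n × (Fin p ⊕ Fin q)) ℂ), Vᴴ * V = 1 ∧ V * Vᴴ = 1 ∧
      ∀ α, Ψ α * V = V * copies p q α := by
  obtain ⟨o⟩ := ‹Nonempty (Fin n)›
  have hE : IsStarProjection (single o o 1 : MatAlg n) :=
    ⟨by simp [IsIdempotentElem], by simp [IsSelfAdjoint, star_eq_conjTranspose]⟩
  obtain ⟨p, q, w, hw, hwE, hwc⟩ := exists_isometry_conjDiagonal (isStarProjection_linearPart Ψ)
    (hE.map Ψ) (commute_linearPart_map Ψ _)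
  let F (j : Fin n) := Ψ (single j o 1)
  have hF (j : Fin n) : (F j)ᴴ = Ψ (single o j 1) := by
    rw [← star_eq_conjTranspose, ← map_star, star_eq_conjTranspose, conjTranspose_single, star_one]
  have hFF (i j : Fin n) : (F i * w)ᴴ * (F j * w) = wᴴ * Ψ (single o i 1 * single j o 1) * w := by
    rw [map_mul, conjTranspose_mul, hF]
    simp only [Matrix.mul_assoc, F]
  refine ⟨p, q, blockColumns fun j => F j * w, ?_, ?_, fun α => ?_⟩
  · refine conjTranspose_blockColumns_mul_self_eq_one (fun j => ?_)
      fun i j hij => show _ = _ from ?_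
    · rw [hFF, single_mul_single_same, mul_one, Matrix.mul_assoc,
        mul_eq_self_of_mul_eq_one hw hwE, hw]
    · rw [hFF, single_mul_single_of_ne _ _ _ _ hij, map_zero, Matrix.mul_zero, Matrix.zero_mul]
  · have hFw (j : Fin n) : F j * w * (F j * w)ᴴ = Ψ (single j j 1) := by
      rw [conjTranspose_mul, Matrix.mul_assoc, ← Matrix.mul_assoc w, hwE, hF, ← map_mul, ← map_mul,
        single_mul_single_same, single_mul_single_same, mul_one, mul_one]
    rw [blockColumns_mul_conjTranspose, Finset.sum_congr rfl fun j _ => hFw j, ← map_sum,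
      sum_single_one, map_one]
  · have hα (j : Fin n) : α * single j o 1 = ∑ l, single l o 1 * (α l j • (1 : MatAlg n)) := by
      ext a b
      by_cases hb : o = b <;> simp [mul_apply, Matrix.sum_apply, single_apply, hb]
    rw [mul_blockColumns, blockColumns_mul_copies]
    refine congrArg blockColumns (funext fun j => ?_)
    rw [← Matrix.mul_assoc, ← map_mul, hα, map_sum, Matrix.sum_mul]
    refine Finset.sum_congr rfl fun l _ => ?_
    rw [map_mul, Matrix.mul_assoc, map_smul_one_eq_linearPart, hwc, Matrix.mul_assoc]

theorem exists_unitary_of_starAlgHom [Nonempty (Fin n)] {m : ℕ} (Ψ : MatAlg n →⋆ₐ[ℝ] MatAlg m) :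
    ∃ (p q : ℕ) (e : Fin n × (Fin p ⊕ Fin q) ≃ Fin m), n * (p + q) = m ∧
      ∃ U ∈ unitary (MatAlg m), ∀ α, Ψ α = U * reindex e e (copies p q α) * star U := by
  obtain ⟨p, q, V, hV, hV', hΨ⟩ := exists_map_mul_eq_mul_copies Ψ
  have hcard : n * (p + q) = m := by
    have h := trace_mul_comm Vᴴ V
    rw [hV, hV', trace_one, trace_one, Nat.cast_inj] at h
    simpa using h
  let e : Fin n × (Fin p ⊕ Fin q) ≃ Fin m := Fintype.equivFinOfCardEq (by simpa using hcard)
  have hU : V.submatrix id e.symm * star (V.submatrix id e.symm) = 1 := by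
    rw [star_eq_conjTranspose, conjTranspose_submatrix, submatrix_mul_equiv, hV', submatrix_id_id]
  refine ⟨p, q, e, hcard, V.submatrix id e.symm, ⟨mul_eq_one_comm.1 hU, hU⟩, fun α => ?_⟩
  have h : Ψ α * V.submatrix id e.symm = V.submatrix id e.symm * reindex e e (copies p q α) := by
    rw [reindex_apply, submatrix_mul_equiv, ← hΨ, submatrix_mul _ _ id id _ Function.bijective_id,
      submatrix_id_id]
  rw [← h, Matrix.mul_assoc, hU, Matrix.mul_one]

end Form

section Uniqueness

variable {R S : Type*} [Ring R] [StarRing R] [Algebra ℝ R] [StarModule ℝ R]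
  [Ring S] [Algebra ℝ S] {A : Submodule ℝ R} {𝒜 : StarSubalgebra ℝ R} {B : Submodule ℝ S}
  {γ : A → B}

theorem eq_of_extends (h1 : (1 : R) ∈ A) (hadj : (𝒜 : Set R) = Algebra.adjoin ℝ (A : Set R))
    {Γ Γ' : 𝒜 →+* S} (hΓ : Extends Γ γ) (hΓ' : Extends Γ' γ) : Γ' = Γ := by
  have hmem {x : R} : x ∈ 𝒜 ↔ x ∈ Algebra.adjoin ℝ (A : Set R) := Set.ext_iff.1 hadj x
  ext ⟨x, hx⟩
  induction hmem.1 hx using Algebra.adjoin_induction with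
  | mem a ha => rw [hΓ _ ⟨a, ha⟩ rfl, hΓ' _ ⟨a, ha⟩ rfl]
  | algebraMap r =>
    have hr : algebraMap ℝ R r ∈ A := Algebra.algebraMap_eq_smul_one (A := R) r ▸ A.smul_mem r h1
    rw [hΓ _ ⟨_, hr⟩ rfl, hΓ' _ ⟨_, hr⟩ rfl]
  | add x y hxA hyA ihx ihy =>
    exact (map_add Γ' ⟨x, hmem.2 hxA⟩ ⟨y, hmem.2 hyA⟩).trans <|
      (congrArg₂ (· + ·) (ihx _) (ihy _)).trans (map_add Γ _ _).symm
  | mul x y hxA hyA ihx ihy =>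
    exact (map_mul Γ' ⟨x, hmem.2 hxA⟩ ⟨y, hmem.2 hyA⟩).trans <|
      (congrArg₂ (· * ·) (ihx _) (ihy _)).trans (map_mul Γ _ _).symm

/-- The ring homomorphism `x ↦ star (Γ (star x))` also extends `γ`, so it equals `Γ`. -/
theorem isExtendedEncoding_of_extends [StarRing S] (hA : IsJordanSubspace A)
    (hB : IsJordanSubspace B) (hadj : (𝒜 : Set R) = Algebra.adjoin ℝ (A : Set R))
    {Γ : 𝒜 →+* S} (hΓ : Extends Γ γ) : IsExtendedEncoding Γ γ := by
  let Γ' : 𝒜 →+* S :=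
    { toFun := fun x => star (Γ (star x))
      map_one' := by simp
      map_mul' := by simp
      map_zero' := by simp
      map_add' := by simp }
  have hΓ' : Extends Γ' γ := fun x a hxa => by
    have hx : star x = x := Subtype.ext <| by rw [StarMemClass.coe_star, hxa, hA.star_eq a a.2]
    change star (Γ (star x)) = γ a
    rw [hx, hΓ x a hxa, hB.star_eq _ (γ a).2]
  refine ⟨hΓ, fun x => star_injective ?_⟩
  rw [star_star]
  exact DFunLike.congr_fun (eq_of_extends hA.one_mem hadj hΓ hΓ') x

end Uniqueness

section Encoding

variable {n : ℕ} {ι : Type*} {m : ι → ℕ} {A : Submodule ℝ (MatAlg n)}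
  {𝒜 : StarSubalgebra ℝ (MatAlg n)} {B : Submodule ℝ (SumMatAlg m)} {γ : A → B}

theorem IsEncoding.exists_isExtendedEncoding (hγ : IsEncoding γ) (hA : IsJordanSubspace A)
    (hsimple : IsSimpleJordan A) (h𝒜 : IsEnveloping A 𝒜) (hB : IsJordanSubspace B)
    (hspin : ¬ (IsSpinFactor A ∧ ∃ k : ℕ, 1 ≤ k ∧ Module.finrank ℝ A = 4 * k + 2)) :
    ∃ Γ : 𝒜 →+* SumMatAlg m, IsExtendedEncoding Γ γ := by
  choose g hg hgγ using hγ.exists_isJordanHom hA hB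
  choose Ψ hΨ using fun i => (hg i).exists_starAlgHom hA hsimple hspin h𝒜.adjoin_eq_top
  refine ⟨RingHom.pi fun i => ((Ψ i).comp 𝒜.subtype : 𝒜 →+* MatAlg (m i)), ?_, ?_⟩
  · intro x a hxa
    funext i
    rw [← hgγ, ← hΨ, ← hxa]
    rfl
  · exact fun x => funext fun i => map_star ((Ψ i).comp 𝒜.subtype) x

theorem IsExtendedEncoding.exists_starAlgHom {Γ : 𝒜 →+* SumMatAlg m}
    (hΓ : IsExtendedEncoding Γ γ) (hγ : IsEncoding γ) (hA : IsJordanSubspace A)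
    (hB : IsJordanSubspace B) (i : ι) :
    ∃ Φ : 𝒜 →⋆ₐ[ℝ] MatAlg (m i), ∀ α, Φ α = Γ α i := by
  obtain ⟨g, hg, hgγ⟩ := hγ.exists_isJordanHom hA hB i
  have hscalar (r : ℝ) : Γ (algebraMap ℝ 𝒜 r) i = algebraMap ℝ (MatAlg (m i)) r := by
    rw [hΓ.extends_map _ (r • ⟨1, hA.one_mem⟩) (Algebra.algebraMap_eq_smul_one r), ← hgγ, map_smul,
      hg.map_one _ rfl, Algebra.algebraMap_eq_smul_one]
  exact ⟨{ (Pi.evalRingHom _ i).comp Γ with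
    commutes' := hscalar
    map_star' := fun α => congrFun (hΓ.map_star α) i }, fun _ => rfl⟩

theorem IsExtendedEncoding.exists_unitary {Γ : 𝒜 →+* SumMatAlg m} (hΓ : IsExtendedEncoding Γ γ)
    (hγ : IsEncoding γ) (hA : IsJordanSubspace A) (hsimple : IsSimpleJordan A)
    (h𝒜 : IsEnveloping A 𝒜) (hB : IsJordanSubspace B) :
    ∃ (p q : ι → ℕ) (e : ∀ i, Fin n × (Fin (p i) ⊕ Fin (q i)) ≃ Fin (m i)),
      (∀ i, n * (p i + q i) = m i) ∧
      ∃ U ∈ unitary (SumMatAlg m), ∀ α : 𝒜,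
        Γ α = U * (fun i => Matrix.reindex (e i) (e i) (copies (p i) (q i) (α : MatAlg n)))
          * star U := by
  have := hsimple.nonempty
  have hgen : Algebra.adjoin ℂ (𝒜 : Set (MatAlg n)) = ⊤ :=
    top_le_iff.1 <| h𝒜.adjoin_eq_top.ge.trans (Algebra.adjoin_mono h𝒜.mem)
  choose Φ hΦ using hΓ.exists_starAlgHom hγ hA hB
  choose Ψ hΨ using fun i => exists_starAlgHom_extension hgen (Φ i)
  choose p q e hpq U hU hform using fun i => exists_unitary_of_starAlgHom (Ψ i)
  refine ⟨p, q, e, hpq, U, ⟨funext fun i => (hU i).1, funext fun i => (hU i).2⟩, fun α => ?_⟩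
  funext i
  rw [← hΦ, ← hΨ, hform]
  rfl

end Encoding

theorem mainTheorem1_general {n : ℕ} {ι : Type*} (m : ι → ℕ)
    (A : Submodule ℝ (MatAlg n)) (hA : IsJordanSubspace A) (hsimple : IsSimpleJordan A)
    (𝒜 : StarSubalgebra ℝ (MatAlg n)) (h𝒜 : IsEnveloping A 𝒜)
    (B : Submodule ℝ (SumMatAlg m)) (hB : IsJordanSubspace B)
    (γ : A → B) (hγ : IsEncoding γ) :
    (¬ (IsSpinFactor A ∧ ∃ k : ℕ, 1 ≤ k ∧ Module.finrank ℝ A = 4 * k + 2) →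
      ∃ Γ : 𝒜 →+* SumMatAlg m, IsExtendedEncoding Γ γ) ∧
    ((𝒜 : Set (MatAlg n)) = Algebra.adjoin ℝ (A : Set (MatAlg n)) →
      ∀ Γ Γ' : 𝒜 →+* SumMatAlg m, Extends Γ γ → Extends Γ' γ →
        IsExtendedEncoding Γ γ ∧ Γ' = Γ) ∧
    (∀ Γ : 𝒜 →+* SumMatAlg m, IsExtendedEncoding Γ γ →
      ∃ (p q : ι → ℕ) (e : ∀ i, Fin n × (Fin (p i) ⊕ Fin (q i)) ≃ Fin (m i)),
        (∀ i, n * (p i + q i) = m i) ∧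
        ∃ U ∈ unitary (SumMatAlg m), ∀ α : 𝒜,
          Γ α = U * (fun i => Matrix.reindex (e i) (e i) (copies (p i) (q i) (α : MatAlg n)))
            * star U) :=
  ⟨hγ.exists_isExtendedEncoding hA hsimple h𝒜 hB,
    fun hadj _ _ hΓ hΓ' =>
      ⟨isExtendedEncoding_of_extends hA hB hadj hΓ, eq_of_extends hA.one_mem hadj hΓ hΓ'⟩,
    fun _ hΓ => hΓ.exists_unitary hγ hA hsimple h𝒜 hB⟩

theorem mainTheorem1 {n : ℕ} {ι : Type*} [Fintype ι] (m : ι → ℕ)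
    (A : Submodule ℝ (MatAlg n)) (hA : IsSpecialJB A) (hsimple : IsSimpleJordan A)
    (𝒜 : StarSubalgebra ℝ (MatAlg n)) (h𝒜 : IsEnveloping A 𝒜)
    (B : Submodule ℝ (SumMatAlg m)) (hB : IsSpecialJB B)
    (γ : A → B) (hγ : IsEncoding γ) :
    (¬ (IsSpinFactor A ∧ ∃ k : ℕ, 1 ≤ k ∧ Module.finrank ℝ A = 4 * k + 2) →
      ∃ Γ : 𝒜 →+* SumMatAlg m, IsExtendedEncoding Γ γ) ∧
    ((𝒜 : Set (MatAlg n)) = Algebra.adjoin ℝ (A : Set (MatAlg n)) →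
      ∀ Γ Γ' : 𝒜 →+* SumMatAlg m, Extends Γ γ → Extends Γ' γ →
        IsExtendedEncoding Γ γ ∧ Γ' = Γ) ∧
    (∀ Γ : 𝒜 →+* SumMatAlg m, IsExtendedEncoding Γ γ →
      ∃ (p q : ι → ℕ) (e : ∀ i, Fin n × (Fin (p i) ⊕ Fin (q i)) ≃ Fin (m i)),
        (∀ i, n * (p i + q i) = m i) ∧
        ∃ U ∈ unitary (SumMatAlg m), ∀ α : 𝒜,
          Γ α = U * (fun i => Matrix.reindex (e i) (e i) (copies (p i) (q i) (α : MatAlg n)))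
            * star U) :=
  mainTheorem1_general m A hA.isJordanSubspace hsimple 𝒜 h𝒜 B hB.isJordanSubspace γ hγ
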